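/- **Setting.** Let $C>0$, $\alpha>0$, $\sigma>0$, let $N_1\ge 1$ be an integer, and put $h=\frac{\sigma\alpha}{\sqrt{N_1}}$ and $T=N_1h=\sigma\alpha\sqrt{N_1}$. For $0\le\beta<2$ let $$S_\beta=\Big\{x e^{\pm \frac{\theta\pi}{2}i}:\ x\in[0,1],\ \theta\in[0,\beta]\Big\},\qquad \varkappa(\beta)=\begin{cases}1,&0\le\beta\le1,\\ \sin\frac{\beta\pi}{2},&1<\beta<2.\end{cases}$$ Let $\ell=\lfloor\alpha\rfloor$ or $\ell=\lceil\alpha\rceil$ (the choices made for the representations of $z^\alpha$ and of $z^\alpha\log z$, respectively), $\kappa=\frac{\alpha}{\ell+1-\alpha}$, $\delta=\frac{\sqrt2-1}{2}$, and let $$s_k=\delta+\tfrac12\Big(1+\cos\tfrac{(2\ell-2k+1)\pi}{2\ell}\Big),\qquad k=1,\dots,\ell,$$ be the roots of the shifted Chebyshev polynomial $\mathrm T_\ell(2s-2\delta-1)$. For $l\in\{0,1\}$, $u\in\mathbb R$ and $z\in S_\beta$, $z\neq0$, let $$f^{(l)}(u,z)=\frac{zC^{\alpha}(u-T)^l e^{u-T}}{Ce^{\frac1\alpha(u-T)}+z}\prod_{k=1}^{\ell}\frac{z-s_k}{Ce^{\frac1\alpha(u-T)}+s_k},$$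 and write $\mathfrak F[f^{(l)}](\xi)=\int_{-\infty}^{+\infty}f^{(l)}(u,z)e^{-2\pi i u\xi}\,\mathrm du$. **Theorem.** For every $C>0$ there is a constant $K>0$, depending only on $C$, such that for all $\beta\in[0,2)$, $\alpha>0$, $\sigma>0$, $N_1\ge1$, $\ell\in\{\lfloor\alpha\rfloor,\lceil\alpha\rceil\}$, $l\in\{0,1\}$ and all $0\ne z\in S_\beta$, the function $f^{(l)}(\cdot,z)$ is integrable on $\mathbb R$, the series below converges, and $$\sum_{n\neq0}\Big|\mathfrak F[f^{(l)}]\Big(\frac nh\Big)\Big|\le K\,\frac{\mathcal G^{\alpha}\max\{1,C^\alpha\}\,(1+\kappa^{l+1})}{\varkappa(\beta)\big[e^{\frac{(2-\beta)\alpha\pi^2}{h}}-1\big]},\qquad \mathcal G=\frac{\sqrt2+2}{\sqrt2-1},$$ where the sum is over all nonzero integers $n$. In the case $\beta=0$, that is $z\in(0,1]$, the same holds (with some constant $K>0$ depending only on $C$) with $\mathcal G=\frac{\sqrt2}{\sqrt2-1}$. -/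

import Mathlib

open scoped FourierTransform

noncomputable section

namespace Lightning

/-- The sector domain `S_β`: all `x e^{± iθπ/2}` with `x ∈ [0,1]` and `θ ∈ [0,β]`. -/
def sector (β : ℝ) : Set ℂ :=
  {z | ∃ x ∈ Set.Icc (0 : ℝ) 1, ∃ θ ∈ Set.Icc (0 : ℝ) β,
    z = (x : ℂ) * Complex.exp (((θ * Real.pi / 2 : ℝ) : ℂ) * Complex.I) ∨
    z = (x : ℂ) * Complex.exp (-(((θ * Real.pi / 2 : ℝ) : ℂ) * Complex.I))}

/-- The factor `ϰ(β)`: it is `1` on `[0,1]` and `sin (βπ/2)` on `(1,2)`. -/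
def varkappa (β : ℝ) : ℝ := if β ≤ 1 then 1 else Real.sin (β * Real.pi / 2)

/-- The shift of the Chebyshev nodes, `δ = (√2 - 1)/2`. -/
def delta : ℝ := (Real.sqrt 2 - 1) / 2

/-- The nodes `s_k`, `1 ≤ k ≤ ℓ`, i.e. the roots of `T_ℓ(2s - 2δ - 1)`. -/
def node (ℓ k : ℕ) : ℝ :=
  delta + (1 + Real.cos ((2 * (ℓ : ℝ) - 2 * (k : ℝ) + 1) * Real.pi / (2 * (ℓ : ℝ)))) / 2

/-- The ratio `κ = α / (ℓ + 1 - α)`. -/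
def kappa (α : ℝ) (ℓ : ℕ) : ℝ := α / ((ℓ : ℝ) + 1 - α)

/-- The step length `h = σα/√N₁`. -/
def step (α σ : ℝ) (N₁ : ℕ) : ℝ := σ * α / Real.sqrt (N₁ : ℝ)

/-- The truncation parameter `T = N₁ h` (which equals `σα√N₁`). -/
def trunc (α σ : ℝ) (N₁ : ℕ) : ℝ := (N₁ : ℝ) * step α σ N₁

/-- The transformed integrand `f^{(l)}(u,z)` built with the `ℓ` nodes `s_1, …, s_ℓ`. -/
def integrand (C α σ : ℝ) (N₁ ℓ l : ℕ) (z : ℂ) (u : ℝ) : ℂ :=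
  z * ((C ^ α * (u - trunc α σ N₁) ^ l * Real.exp (u - trunc α σ N₁) : ℝ) : ℂ)
      / (((C * Real.exp ((u - trunc α σ N₁) / α) : ℝ) : ℂ) + z)
    * ∏ k ∈ Finset.Icc 1 ℓ,
        (z - (node ℓ k : ℂ))
          / (((C * Real.exp ((u - trunc α σ N₁) / α) : ℝ) : ℂ) + (node ℓ k : ℂ))

/-- The rate
`G^α max{1, C^α} (1 + κ^{l+1}) / (ϰ(β) [e^{(2-β)απ²/h} - 1])`. -/
def rate (G C α σ β : ℝ) (N₁ ℓ l : ℕ) : ℝ :=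
  G ^ α * max 1 (C ^ α) * (1 + kappa α ℓ ^ (l + 1))
    / (varkappa β
        * (Real.exp ((2 - β) * α * Real.pi ^ 2 / step α σ N₁) - 1))

/-- The Fourier transforms `𝓕[f^{(l)}](n/h)`, `n ≠ 0`, exist as absolutely convergent integrals,
and the sum of their moduli converges and is at most `B`. -/
def FourierSumLE (C α σ : ℝ) (N₁ ℓ l : ℕ) (z : ℂ) (B : ℝ) : Prop :=
  MeasureTheory.Integrable (integrand C α σ N₁ ℓ l z) ∧
  Summable (fun n : {n : ℤ // n ≠ 0} =>
    ‖𝓕 (integrand C α σ N₁ ℓ l z) (((n : ℤ) : ℝ) / step α σ N₁)‖) ∧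
  ∑' n : {n : ℤ // n ≠ 0},
    ‖𝓕 (integrand C α σ N₁ ℓ l z) (((n : ℤ) : ℝ) / step α σ N₁)‖ ≤ B

end Lightning

end

/-! ### Chebyshev polynomials at the shifted nodes -/

namespace Lightning

open Polynomial Finset

/-! The substitution `x = log C + (u - T)/α` turns `𝓕 f(ξ)` into `α^(l+1)` times, up to a phase, the
integral over the real line of `z ∏ (z - s_k) (x - log C)^l e^(s x) / ((e^x + z) ∏ (e^x + s_k))`,
where `s = α - 2πiαξ`. The power `C^α` is absorbed by `e^(αx)`. Conjugating `z` reduces to `ξ ≤ 0`,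
so that `Im s = 2πα|ξ| ≥ 0`.

The denominator has period `2πi`. Moving the line up by `2πi` (`integral_sub_integral_shift`) leaves
an integral of size `e^(-2π Im s)` and residues at `log p + iπ` for `p = z, s_1, …, s_ℓ`. Such a
residue carries `e^(-(arg p + π) Im s)`, and `|arg z| ≤ βπ/2` bounds all of these by
`e^(-(2-β)π²α|ξ|)`. At `ξ = n/h` this is a geometric sequence in `|n|`, whose sum gives the
denominator of the rate.

The prefactors remain. The integrand decays like `e^(αx)` on the left and `e^(-(ℓ+1-α)x)` on the
right, which produces `1 + κ^(l+1)`; the bound `|y + z| ≥ ϰ(β) max(y, |z|)` produces `1/ϰ(β)`. In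
the residue at `z` the node product cancels; in the residue at `s_k` it becomes a Lagrange basis
function, estimated through `T_ℓ` in `nodeBounds_of_norm_le_one` and `nodeBounds_of_mem_Ioc`.
Everything grows at most like `(1+α)^4 q^α` with `q` strictly below `𝒢`, so the gap absorbs the
polynomial factor. If `z` is a node, the integrand vanishes. -/

theorem two_delta_add_one : 2 * delta + 1 = Real.sqrt 2 := by
  unfold delta; ring

theorem sqrt_two_bounds : (1.41421 : ℝ) < Real.sqrt 2 ∧ Real.sqrt 2 < 1.41422 :=
  ⟨Real.lt_sqrt_of_sq_lt (by norm_num), (Real.sqrt_lt' (by norm_num)).2 (by norm_num)⟩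

theorem delta_bounds : (0.2071 : ℝ) < delta ∧ delta < 0.20712 := by
  have := sqrt_two_bounds
  unfold delta
  constructor <;> linarith [this.1, this.2]

theorem delta_pos : 0 < delta := by linarith [delta_bounds.1]

/-- The angle of the Chebyshev node belonging to `node ℓ k`. -/
noncomputable def nodeAngle (ℓ k : ℕ) : ℝ := (2 * (ℓ : ℝ) - 2 * (k : ℝ) + 1) * Real.pi / (2 * (ℓ : ℝ))

theorem two_node_sub (ℓ k : ℕ) : 2 * node ℓ k - Real.sqrt 2 = Real.cos (nodeAngle ℓ k) := by
  rw [← two_delta_add_one, node, nodeAngle]; ring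

theorem delta_le_node (ℓ k : ℕ) : delta ≤ node ℓ k := by
  unfold node
  linarith [Real.neg_one_le_cos ((2 * (ℓ : ℝ) - 2 * (k : ℝ) + 1) * Real.pi / (2 * (ℓ : ℝ)))]

theorem node_le (ℓ k : ℕ) : node ℓ k ≤ 1 + delta := by
  unfold node
  linarith [Real.cos_le_one ((2 * (ℓ : ℝ) - 2 * (k : ℝ) + 1) * Real.pi / (2 * (ℓ : ℝ)))]

theorem node_pos (ℓ k : ℕ) : 0 < node ℓ k := delta_pos.trans_le (delta_le_node ℓ k)

theorem nodeAngle_eq {ℓ k : ℕ} (hk : k ≤ ℓ) :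
    nodeAngle ℓ k = (2 * ((ℓ - k : ℕ) : ℝ) + 1) * Real.pi / (2 * (ℓ : ℝ)) := by
  rw [nodeAngle, Nat.cast_sub hk]; ring

theorem node_injOn (ℓ : ℕ) : Set.InjOn (node ℓ) (Icc 1 ℓ : Finset ℕ) := by
  intro a ha b hb hab
  have h1 := (Finset.range ℓ).nodup_map_iff_injOn.mp (Chebyshev.roots_T_real_nodup ℓ)
  simp only [coe_Icc, Set.mem_Icc] at ha hb
  have h2 : Real.cos (nodeAngle ℓ a) = Real.cos (nodeAngle ℓ b) := by
    rw [← two_node_sub, ← two_node_sub, hab]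
  rw [nodeAngle_eq ha.2, nodeAngle_eq hb.2] at h2
  have h3 := @h1 (ℓ - a) (by simp; omega) (ℓ - b) (by simp; omega) h2
  omega

/-- The shifted Chebyshev polynomial factors over the nodes. -/
theorem exists_chebyshev_eq_prod (ℓ : ℕ) : ∃ c : ℝ, 0 < c ∧
    (Chebyshev.T ℝ ℓ).comp (C 2 * X - C (Real.sqrt 2))
      = C c * Lagrange.nodal (Icc 1 ℓ) (node ℓ) := by
  -- Each linear factor `(2y - √2) - cos θ_k` equals `2 (y - s_k)`; this accounts for `2 ^ ℓ`.
  refine ⟨(Chebyshev.T ℝ ℓ).leadingCoeff * 2 ^ ℓ, ?_, ?_⟩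
  · rw [Chebyshev.leadingCoeff_T]; positivity
  have hcard : Multiset.card (Chebyshev.T ℝ ℓ).roots = (Chebyshev.T ℝ ℓ).natDegree := by
    rw [Chebyshev.roots_T_real, Chebyshev.natDegree_T, Finset.card_val,
      Finset.card_image_of_injOn
        ((Finset.range ℓ).nodup_map_iff_injOn.mp (Chebyshev.roots_T_real_nodup ℓ))]
    simp
  refine Polynomial.funext fun y => ?_
  have h := C_leadingCoeff_mul_prod_multiset_X_sub_C hcard
  have h2 : (Chebyshev.T ℝ ℓ).eval (2 * y - Real.sqrt 2) = (Chebyshev.T ℝ ℓ).leadingCoeff *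
      ∏ k ∈ Icc 1 ℓ, ((2 * y - Real.sqrt 2) - Real.cos (nodeAngle ℓ k)) := by
    conv_lhs => rw [← h]
    rw [eval_mul, eval_C, Chebyshev.roots_T_real]
    congr 1
    change eval _ (∏ a ∈ (Finset.range ℓ).image _, (X - C a)) = _
    rw [Finset.prod_image
      ((Finset.range ℓ).nodup_map_iff_injOn.mp (Chebyshev.roots_T_real_nodup ℓ)), eval_prod]
    -- The roots are listed by `j = 0, …, ℓ-1` in the opposite order: `j = ℓ - k`.
    refine Finset.prod_bij' (fun j _ => ℓ - j) (fun k _ => ℓ - k) ?_ ?_ ?_ ?_ ?_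
    · intro j hj; simp at hj ⊢; omega
    · intro j hj; simp at hj ⊢; omega
    · intro j hj; simp at hj ⊢; omega
    · intro j hj; simp at hj ⊢; omega
    · intro j hj
      simp at hj
      rw [nodeAngle_eq (by omega), Nat.sub_sub_self hj.le]
      simp
  simp only [eval_comp, eval_sub, eval_mul, eval_C, eval_X, Lagrange.eval_nodal]
  rw [h2, mul_assoc]
  congr 1
  have : ∀ k, (2 * y - Real.sqrt 2) - Real.cos (nodeAngle ℓ k) = 2 * (y - node ℓ k) := by
    intro k; rw [← two_node_sub]; ring
  simp_rw [this, Finset.prod_mul_distrib]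
  simp

/-- With `x = cosh t`, `T_ℓ(x) = cosh ℓt ≤ e^(ℓt)`, and `e^t = x + √(x² - 1)`. -/
theorem chebyshev_eval_le_pow (ℓ : ℕ) {x : ℝ} (hx : 1 ≤ x) :
    (Chebyshev.T ℝ ℓ).eval x ≤ (x + Real.sqrt (x ^ 2 - 1)) ^ ℓ := by
  rw [← Real.exp_arcosh hx, ← Real.exp_nat_mul]
  conv_lhs => rw [← Real.cosh_arcosh hx]
  rw [Chebyshev.T_real_cosh, Real.cosh_eq]
  have h0 := Real.arcosh_nonneg hx
  have : Real.exp (-(((ℓ : ℕ) : ℤ) * Real.arcosh x)) ≤ Real.exp (((ℓ : ℕ) : ℤ) * Real.arcosh x) := by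
    gcongr
    push_cast
    have : 0 ≤ (ℓ : ℝ) * Real.arcosh x := by positivity
    linarith
  push_cast at *
  linarith

theorem abs_sin_nat_mul_le (n : ℕ) (t : ℝ) : |Real.sin (n * t)| ≤ n * |Real.sin t| := by
  induction n with
  | zero => simp
  | succ n ih =>
    push_cast
    rw [add_mul, one_mul, Real.sin_add]
    refine (abs_add_le _ _).trans ?_
    rw [abs_mul, abs_mul]
    have h1 := Real.abs_cos_le_one t
    have h2 := Real.abs_cos_le_one (n * t)
    nlinarith [abs_nonneg (Real.sin (n * t)), abs_nonneg (Real.sin t), abs_nonneg (Real.cos t)]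

/-- A Markov-type Lipschitz bound: writing both points as cosines, the difference of cosines is a
product of two sines, and `|sin nt| ≤ n |sin t|` applies to each. -/
theorem abs_chebyshev_sub_le (ℓ : ℕ) {x y : ℝ} (hx : x ∈ Set.Icc (-1) 1) (hy : y ∈ Set.Icc (-1) 1) :
    |(Chebyshev.T ℝ ℓ).eval x - (Chebyshev.T ℝ ℓ).eval y| ≤ ℓ ^ 2 * |x - y| := by
  rw [← Real.cos_arccos hx.1 hx.2, ← Real.cos_arccos hy.1 hy.2, Chebyshev.T_real_cos,
    Chebyshev.T_real_cos]
  set a := Real.arccos x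
  set b := Real.arccos y
  rw [Real.cos_sub_cos, Real.cos_sub_cos]
  have e1 : (((ℓ : ℤ) : ℝ) * a + ((ℓ : ℤ) : ℝ) * b) / 2 = ℓ * ((a + b) / 2) := by push_cast; ring
  have e2 : (((ℓ : ℤ) : ℝ) * a - ((ℓ : ℤ) : ℝ) * b) / 2 = ℓ * ((a - b) / 2) := by push_cast; ring
  rw [e1, e2, abs_mul, abs_mul, abs_mul, abs_mul]
  have := mul_le_mul (abs_sin_nat_mul_le ℓ ((a + b) / 2)) (abs_sin_nat_mul_le ℓ ((a - b) / 2))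
    (abs_nonneg _) (by positivity)
  norm_num
  nlinarith

/-- Consequences of the Chebyshev factorisation, with a common normalising constant `c`. -/
theorem exists_node_prod_bounds (ℓ : ℕ) : ∃ c : ℝ, 0 < c ∧
    (∀ y : ℝ, (Chebyshev.T ℝ ℓ).eval (2 * y - Real.sqrt 2) = c * ∏ k ∈ Icc 1 ℓ, (y - node ℓ k)) ∧
    ∀ k ∈ Icc 1 ℓ, 2 * ℓ ≤ c * ∏ i ∈ (Icc 1 ℓ).erase k, |node ℓ k - node ℓ i| := by
  obtain ⟨c, hc, h⟩ := exists_chebyshev_eq_prod ℓ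
  refine ⟨c, hc, fun y => ?_, fun k hk => ?_⟩
  · have := congrArg (eval y) h
    simpa [eval_comp, Lagrange.eval_nodal] using this
  -- Differentiating the factorisation at `s_k` gives `2ℓ U_{ℓ-1}(cos θ_k) = c ∏ (s_k - s_i)`. Since
  -- `U_{ℓ-1}(cos θ) sin θ = sin ℓθ`, which is `±1` at `θ_k`, the left side has modulus at least
  -- `2ℓ`.
  · have h1 := congrArg (fun P => eval (node ℓ k) (derivative P)) h
    simp only [derivative_comp, derivative_C_mul, eval_mul, eval_C, eval_comp,
      Chebyshev.T_derivative_eq_U] at h1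
    rw [Lagrange.eval_nodal_derivative_eval_node_eq hk, Lagrange.eval_nodal] at h1
    simp only [derivative_sub, derivative_mul, derivative_C, derivative_X, eval_sub, eval_mul,
      eval_C, eval_X, eval_add, eval_one, eval_zero, eval_intCast] at h1
    rw [two_node_sub] at h1
    have hU := Chebyshev.U_real_cos (nodeAngle ℓ k) ((ℓ : ℤ) - 1)
    have hkl := Finset.mem_Icc.1 hk
    have hl : (ℓ : ℝ) ≠ 0 := by
      have : 0 < ℓ := by omega
      positivity
    have hs : |Real.sin (((((ℓ : ℤ) - 1 : ℤ) : ℝ) + 1) * nodeAngle ℓ k)| = 1 := by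
      rw [nodeAngle_eq hkl.2]
      have e : ((((ℓ : ℤ) - 1 : ℤ) : ℝ) + 1) * ((2 * ((ℓ - k : ℕ) : ℝ) + 1) * Real.pi / (2 * ℓ))
          = ((ℓ - k : ℕ) : ℝ) * Real.pi + Real.pi / 2 := by
        push_cast
        field_simp
        ring
      rw [e, Real.sin_add_pi_div_two, Real.abs_cos_eq_one_iff]
      exact ⟨((ℓ - k : ℕ) : ℤ), by push_cast; rfl⟩
    have hU1 : 1 ≤ |(Chebyshev.U ℝ ((ℓ : ℤ) - 1)).eval (Real.cos (nodeAngle ℓ k))| := by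
      rw [← hs, ← hU, abs_mul]
      exact mul_le_of_le_one_right (abs_nonneg _) (Real.abs_sin_le_one _)
    have h2 := congrArg abs h1
    simp only [abs_mul, Finset.abs_prod] at h2
    rw [abs_of_pos hc] at h2
    rw [← h2]
    simp
    nlinarith [(Nat.cast_nonneg ℓ : (0:ℝ) ≤ ℓ)]

end Lightning

/-! ### Exponential bounds on the node products -/

namespace Lightning

open Polynomial Finset

/-- The two size estimates on the node products that the Fourier bound needs. -/
structure NodeBounds (q : ℝ) (ℓ : ℕ) (z : ℂ) : Prop where
  small : ∀ y : ℝ, 0 < y → y ≤ 1 → ∏ k ∈ Icc 1 ℓ, (‖z - node ℓ k‖ / (y + node ℓ k)) ≤ q ^ ℓ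
  large : ∀ y : ℝ, 1 ≤ y →
    ∏ k ∈ Icc 1 ℓ, (‖z - node ℓ k‖ / (y + node ℓ k)) ≤ q ^ ℓ * (y ^ ℓ)⁻¹
  basis : ∀ k ∈ Icc 1 ℓ,
    (∏ i ∈ (Icc 1 ℓ).erase k, (‖z - node ℓ i‖ / |node ℓ k - node ℓ i|)) * (1 + delta) ^ ℓ
      ≤ 3 * (ℓ + 1) * q ^ ℓ

theorem prod_le_pow_of_le {q : ℝ} {ℓ : ℕ} {f : ℕ → ℝ} (h0 : ∀ k, 0 ≤ f k) (h : ∀ k, f k ≤ q) :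
    ∏ k ∈ Icc 1 ℓ, f k ≤ q ^ ℓ := by
  refine (Finset.prod_le_prod (fun k _ => h0 k) fun k _ => h k).trans ?_
  simp

theorem prod_le_pow_mul_inv_of_le {q y : ℝ} (hy : 0 < y) {ℓ : ℕ} {f : ℕ → ℝ} (h0 : ∀ k, 0 ≤ f k)
    (h : ∀ k, y * f k ≤ q) : ∏ k ∈ Icc 1 ℓ, f k ≤ q ^ ℓ * (y ^ ℓ)⁻¹ := by
  rw [← inv_pow, ← mul_pow]
  refine prod_le_pow_of_le h0 fun k => ?_
  rw [← div_eq_mul_inv, le_div_iff₀ hy, mul_comm]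
  exact h k

theorem norm_sub_node_le {z : ℂ} (hz : ‖z‖ ≤ 1) (ℓ k : ℕ) : ‖z - node ℓ k‖ ≤ 1 + node ℓ k := by
  refine (norm_sub_le _ _).trans ?_
  rw [Complex.norm_real, Real.norm_of_nonneg (node_pos ℓ k).le]
  linarith

/-- Multiplying numerator and denominator by the normalising constant `c` makes both comparable with
values of `T_ℓ`. The factor `(1 + delta) ^ ℓ` is carried along because the residue at `s_k` contains
`s_k^α`, with `s_k ≤ 1 + delta`. -/
theorem basis_prod_le {ℓ k : ℕ} {c M q : ℝ} (hc : 0 < c) {z : ℂ}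
    (hk : k ∈ Icc 1 ℓ)
    (hlow : 2 * ℓ ≤ c * ∏ i ∈ (Icc 1 ℓ).erase k, |node ℓ k - node ℓ i|)
    (hup : c * ∏ i ∈ (Icc 1 ℓ).erase k, ‖z - node ℓ i‖ ≤ M)
    (hM : M * (1 + delta) ^ ℓ ≤ (2 * ℓ) * (3 * (ℓ + 1) * q ^ ℓ)) :
    (∏ i ∈ (Icc 1 ℓ).erase k, (‖z - node ℓ i‖ / |node ℓ k - node ℓ i|)) * (1 + delta) ^ ℓ
      ≤ 3 * (ℓ + 1) * q ^ ℓ := by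
  have hl : (0 : ℝ) < 2 * ℓ := by
    have := Finset.mem_Icc.1 hk
    have : 0 < ℓ := by omega
    positivity
  have hd := delta_pos
  have hM0 : 0 ≤ M := le_trans (by positivity) hup
  rw [Finset.prod_div_distrib, ← mul_div_mul_left _ _ hc.ne']
  calc _ ≤ M / (2 * ℓ) * (1 + delta) ^ ℓ := by gcongr
    _ = (M * (1 + delta) ^ ℓ) / (2 * ℓ) := by ring
    _ ≤ _ := by rwa [div_le_iff₀' hl]

theorem nodeBounds_of_norm_le_one (ℓ : ℕ) {z : ℂ} (hz : ‖z‖ ≤ 1) : NodeBounds 8.1 ℓ z := by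
  have hδ := delta_bounds
  have hs2 := sqrt_two_bounds
  refine ⟨fun y hy _ => prod_le_pow_of_le (fun k => ?_) fun k => ?_,
    fun y hy => prod_le_pow_mul_inv_of_le (by linarith) (fun k => ?_) fun k => ?_, fun k hk => ?_⟩
  · have := node_pos ℓ k; positivity
  · have h1 := delta_le_node ℓ k
    rw [div_le_iff₀ (by linarith [node_pos ℓ k])]
    have := norm_sub_node_le hz ℓ k
    nlinarith
  · have := node_pos ℓ k; positivity
  · have h1 := node_pos ℓ k
    have h2 := node_le ℓ k
    have h3 := norm_sub_node_le hz ℓ k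
    rw [← mul_div_assoc, div_le_iff₀ (by linarith)]
    nlinarith [norm_nonneg (z - node ℓ k)]
  · obtain ⟨c, hc, hT, hlow⟩ := exists_node_prod_bounds ℓ
    have hl : (1 : ℝ) ≤ ℓ := by
      have := Finset.mem_Icc.1 hk
      exact_mod_cast this.1.trans this.2
    -- The worst point of the disc is `z = -1`, where `c ∏ (1 + s_k) = T_ℓ(2 + √2)`; the missing
    -- factor `1 + s_k ≥ 1` may be restored.
    refine basis_prod_le hc hk (hlow k hk)
      (M := (2 + Real.sqrt 2 + Real.sqrt ((2 + Real.sqrt 2) ^ 2 - 1)) ^ ℓ) ?_ ?_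
    · refine le_trans ?_ (chebyshev_eval_le_pow ℓ (x := 2 + Real.sqrt 2) (by linarith [hs2.1]))
      have hT' := congrArg abs (hT (-1))
      rw [abs_mul, abs_of_pos hc, Finset.abs_prod] at hT'
      have h1 : (Chebyshev.T ℝ ℓ).eval (2 + Real.sqrt 2) = c * ∏ k ∈ Icc 1 ℓ, (1 + node ℓ k) := by
        rw [show 2 * (-1 : ℝ) - Real.sqrt 2 = -(2 + Real.sqrt 2) by ring, Chebyshev.T_eval_neg,
          abs_mul, abs_unit_intCast, one_mul, abs_of_pos (zero_lt_one.trans_le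
            (Chebyshev.one_le_eval_T_real ℓ (by linarith [hs2.1])))] at hT'
        rw [hT']
        congr 1
        refine Finset.prod_congr rfl fun i _ => ?_
        rw [abs_of_neg (by linarith [node_pos ℓ i])]
        ring
      rw [h1]
      gcongr
      refine (Finset.prod_le_prod (fun i _ => norm_nonneg _)
        fun i _ => norm_sub_node_le hz ℓ i).trans ?_
      refine Finset.prod_le_prod_of_subset_of_one_le (Finset.erase_subset _ _)
        (fun i _ => ?_) fun i _ _ => ?_ <;> linarith [node_pos ℓ i]
    · rw [← mul_pow]
      -- The resulting base, `(2 + √2 + 3.2646)(1 + δ) ≈ 8.06`, is what requires `q = 8.1`.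
      have hr : Real.sqrt ((2 + Real.sqrt 2) ^ 2 - 1) ≤ 3.2646 := by
        rw [Real.sqrt_le_left (by norm_num)]
        nlinarith
      have h0 := Real.sqrt_nonneg ((2 + Real.sqrt 2) ^ 2 - 1)
      calc _ ≤ (8.1 : ℝ) ^ ℓ := by
            refine pow_le_pow_left₀ (mul_nonneg (by linarith) (by linarith)) ?_ ℓ
            nlinarith
        _ ≤ _ := by
          rw [← mul_assoc]
          refine le_mul_of_one_le_left (by positivity) ?_
          nlinarith

/-- For `x ≥ δ` the argument `2x - √2` lies in `[-1, 1]`, where `|T_ℓ| ≤ 1`; for `x < δ` every `|x -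
s_k|` is at most `s_k`. In both cases the node product at `x` is dominated by the one at `0`, which
is `T_ℓ(√2)/c`. -/
theorem nodeBounds_of_mem_Ioc (ℓ : ℕ) {x : ℝ} (hx0 : 0 < x) (hx1 : x ≤ 1)
    (hne : ∀ k ∈ Icc 1 ℓ, x ≠ node ℓ k) : NodeBounds 3.4 ℓ (x : ℂ) := by
  have hδ := delta_bounds
  have hs2 := sqrt_two_bounds
  have hnorm : ∀ k, ‖(x : ℂ) - node ℓ k‖ = |x - node ℓ k| := fun k => by
    rw [← Complex.ofReal_sub, Complex.norm_real, Real.norm_eq_abs]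
  obtain ⟨c, hc, hT, hlow⟩ := exists_node_prod_bounds ℓ
  have hT0 : (Chebyshev.T ℝ ℓ).eval (Real.sqrt 2) = c * ∏ k ∈ Icc 1 ℓ, node ℓ k := by
    have hT' := congrArg abs (hT 0)
    rw [abs_mul, abs_of_pos hc, Finset.abs_prod, mul_zero, zero_sub, Chebyshev.T_eval_neg, abs_mul,
      abs_unit_intCast, one_mul, abs_of_pos (zero_lt_one.trans_le
        (Chebyshev.one_le_eval_T_real ℓ (by linarith [hs2.1])))] at hT'
    rw [hT']
    congr 1
    refine Finset.prod_congr rfl fun i _ => ?_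
    rw [zero_sub, abs_neg, abs_of_pos (node_pos ℓ i)]
  have hsmallfac : x < delta → ∀ k, |x - node ℓ k| ≤ node ℓ k := fun h k => by
    rw [abs_le]; constructor <;> linarith [delta_le_node ℓ k]
  have hmem : delta ≤ x → 2 * x - Real.sqrt 2 ∈ Set.Icc (-1 : ℝ) 1 := fun h => by
    rw [← two_delta_add_one]; constructor <;> linarith
  have hP : ∏ k ∈ Icc 1 ℓ, |x - node ℓ k| ≤ ∏ k ∈ Icc 1 ℓ, node ℓ k := by
    rcases lt_or_ge x delta with h | h
    · exact Finset.prod_le_prod (fun _ _ => abs_nonneg _) fun k _ => hsmallfac h k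
    · refine le_of_mul_le_mul_left ?_ hc
      rw [← hT0, ← Finset.abs_prod, ← abs_of_pos hc, ← abs_mul, ← hT x]
      exact (Chebyshev.abs_eval_T_real_le_one ℓ (abs_le.2 (hmem h))).trans
        (Chebyshev.one_le_eval_T_real ℓ (by linarith [hs2.1]))
  refine ⟨fun y hy _ => ?_,
    fun y hy => prod_le_pow_mul_inv_of_le (by linarith) (fun k => ?_) fun k => ?_, fun k hk => ?_⟩
  · refine le_trans ?_ (one_le_pow₀ (by norm_num : (1 : ℝ) ≤ 3.4))
    rw [Finset.prod_div_distrib]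
    refine div_le_one_of_le₀ ?_ (Finset.prod_nonneg fun i _ => by linarith [node_pos ℓ i])
    simp_rw [hnorm]
    exact hP.trans (Finset.prod_le_prod (fun i _ => (node_pos ℓ i).le) fun i _ => by linarith)
  · have := node_pos ℓ k; positivity
  · have h1 := node_pos ℓ k
    have h2 := node_le ℓ k
    have h3 : |x - node ℓ k| ≤ 3.4 := by rw [abs_le]; constructor <;> linarith
    rw [hnorm, ← mul_div_assoc, div_le_iff₀ (by linarith)]
    nlinarith [abs_nonneg (x - node ℓ k)]
  · have hl : (1 : ℝ) ≤ ℓ := by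
      have := Finset.mem_Icc.1 hk
      exact_mod_cast this.1.trans this.2
    rcases lt_or_ge x delta with h | h
    -- `c ∏ s_i = T_ℓ(√2) ≤ (√2 + 1)^ℓ`, and the omitted factor `s_k` is at least `δ`. The base is
    -- then `(√2 + 1)(1 + δ) ≈ 2.91`.
    · refine basis_prod_le hc hk (hlow k hk) (M := (Real.sqrt 2 + 1) ^ ℓ / delta) ?_ ?_
      · have h1 := chebyshev_eval_le_pow ℓ (x := Real.sqrt 2) (by linarith [hs2.1])
        rw [Real.sq_sqrt (by norm_num), show (2 : ℝ) - 1 = 1 by norm_num, Real.sqrt_one, hT0,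
          ← Finset.mul_prod_erase _ _ hk] at h1
        rw [le_div_iff₀ delta_pos]
        refine le_trans ?_ h1
        simp_rw [hnorm]
        have h2 : ∏ i ∈ (Icc 1 ℓ).erase k, |x - node ℓ i| ≤ ∏ i ∈ (Icc 1 ℓ).erase k, node ℓ i :=
          Finset.prod_le_prod (fun _ _ => abs_nonneg _) fun i _ => hsmallfac h i
        have h3 : 0 ≤ ∏ i ∈ (Icc 1 ℓ).erase k, |x - node ℓ i| :=
          Finset.prod_nonneg fun _ _ => abs_nonneg _
        calc _ = c * (delta * ∏ i ∈ (Icc 1 ℓ).erase k, |x - node ℓ i|) := by ring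
          _ ≤ _ := by
            gcongr
            · exact (node_pos ℓ k).le
            · exact delta_le_node ℓ k
      · rw [div_mul_eq_mul_div, ← mul_pow, div_le_iff₀ delta_pos]
        calc _ ≤ (3.4 : ℝ) ^ ℓ := by
              refine pow_le_pow_left₀ (mul_nonneg (by linarith) (by linarith)) ?_ ℓ
              nlinarith
          _ = 1 * (3.4 : ℝ) ^ ℓ := by ring
          _ ≤ (2 * ℓ * (3 * (ℓ + 1)) * delta) * (3.4 : ℝ) ^ ℓ := by
              have h6 : 12 ≤ 2 * (ℓ : ℝ) * (3 * (ℓ + 1)) := by nlinarith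
              gcongr
              nlinarith
          _ = _ := by ring
    -- Since `T_ℓ` vanishes at `cos θ_k`, the Lipschitz bound gives `|T_ℓ(2x - √2)| ≤ 2ℓ² |x -
    -- s_k|`, and `|x - s_k|` cancels.
    · refine basis_prod_le hc hk (hlow k hk) (M := 2 * ℓ ^ 2) ?_ ?_
      · have hT1 := hT x
        rw [← Finset.mul_prod_erase _ _ hk] at hT1
        have hTk := hT (node ℓ k)
        rw [Finset.prod_eq_zero hk (sub_self _), mul_zero] at hTk
        have h4 := abs_chebyshev_sub_le ℓ (hmem h) (y := 2 * node ℓ k - Real.sqrt 2)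
          (by rw [two_node_sub]; exact ⟨Real.neg_one_le_cos _, Real.cos_le_one _⟩)
        rw [hTk, sub_zero, hT1, show 2 * x - Real.sqrt 2 - (2 * node ℓ k - Real.sqrt 2)
          = 2 * (x - node ℓ k) by ring, abs_mul, abs_mul, abs_mul, abs_of_pos hc,
          Finset.abs_prod] at h4
        simp_rw [hnorm]
        refine le_of_mul_le_mul_left ?_ (abs_pos.2 (sub_ne_zero.2 (hne k hk)))
        rw [abs_two] at h4
        linarith
      · have h5 : (1 + delta) ^ ℓ ≤ (3.4 : ℝ) ^ ℓ := pow_le_pow_left₀ (by linarith) (by linarith) ℓ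
        calc _ ≤ 2 * (ℓ : ℝ) ^ 2 * 3.4 ^ ℓ := by gcongr
          _ = (2 * ℓ) * (ℓ * 3.4 ^ ℓ) := by ring
          _ ≤ _ := by gcongr; linarith

end Lightning

/-! ### Shifting the contour by the period of the exponential -/

namespace Lightning

open Complex Filter Topology Set MeasureTheory

/-- The closed horizontal strip `0 ≤ Im w ≤ 2π`. -/
def periodStrip : Set ℂ := {w | w.im ∈ Icc 0 (2 * Real.pi)}

/-- Convergence along `comap re F ⊓ 𝓟 periodStrip` is convergence uniform in the height, so it
passes to the integral over a vertical segment. -/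
theorem tendsto_integral_vertical {g : ℂ → ℂ} {L : ℂ} {F : Filter ℝ}
    (hc : ContinuousOn g periodStrip)
    (hg : Tendsto g (comap re F ⊓ 𝓟 periodStrip) (𝓝 L)) :
    Tendsto (fun R : ℝ => ∫ y : ℝ in (0)..(2 * Real.pi), g (R + y * I)) F
      (𝓝 (2 * Real.pi * L)) := by
  have hpi : (0 : ℝ) ≤ 2 * Real.pi := by positivity
  have hL : ∫ _ in (0)..(2 * Real.pi), L = 2 * Real.pi * L := by simp
  rw [Metric.tendsto_nhds]
  intro ε hε
  have h1 := (Metric.tendsto_nhds.1 hg) (ε / (2 * Real.pi + 1)) (by positivity)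
  rw [eventually_inf_principal, eventually_comap] at h1
  filter_upwards [h1] with R hR
  have hmem : ∀ y ∈ Icc 0 (2 * Real.pi), (R + y * I : ℂ) ∈ periodStrip := fun y hy => by
    simpa [periodStrip] using hy
  have hcont : ContinuousOn (fun y : ℝ => g (R + y * I)) (uIcc 0 (2 * Real.pi)) := by
    rw [uIcc_of_le hpi]
    exact hc.comp (by fun_prop) hmem
  rw [dist_eq_norm, ← hL, ← intervalIntegral.integral_sub hcont.intervalIntegrable (by simp)]
  refine lt_of_le_of_lt (intervalIntegral.norm_integral_le_of_norm_le_const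
    (C := ε / (2 * Real.pi + 1)) fun y hy => ?_) ?_
  · rw [uIoc_of_le hpi] at hy
    have := hR (R + y * I) (by simp) (hmem y ⟨hy.1.le, hy.2⟩)
    rw [dist_eq_norm] at this
    exact this.le
  · rw [sub_zero, abs_of_nonneg hpi, div_mul_eq_mul_div, div_lt_iff₀ (by positivity)]
    nlinarith

/-- The zero of `w ↦ e^w + p` in the strip `0 < Im w < 2π`. -/
noncomputable def pole (p : ℂ) : ℂ := log p + Real.pi * I

theorem exp_pole {p : ℂ} (hp : p ≠ 0) : exp (pole p) = -p := by
  rw [pole, exp_add, exp_pi_mul_I, exp_log hp]; ring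

theorem pole_re (p : ℂ) : (pole p).re = Real.log ‖p‖ := by simp [pole, log_re]

theorem pole_im (p : ℂ) : (pole p).im = arg p + Real.pi := by simp [pole, log_im]

theorem pole_im_mem {p : ℂ} (hp : p ∈ slitPlane) : (pole p).im ∈ Ioo 0 (2 * Real.pi) := by
  rw [pole_im]
  have h1 := neg_pi_lt_arg p
  have h2 := (arg_le_pi p).lt_of_ne (mem_slitPlane_iff_arg.1 hp).1
  constructor <;> linarith

/-- The zeros differ by multiples of `2πi`, and `pole p` lies in the open strip because `arg p ≠ π`;
hence the closed strip contains no other. -/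
theorem exp_add_ne_zero {p w : ℂ} (hp : p ∈ slitPlane) (hw : w ∈ periodStrip) (hne : w ≠ pole p) :
    exp w + p ≠ 0 := by
  intro h
  have h0 : exp w = exp (pole p) := by
    rw [exp_pole (slitPlane_ne_zero hp)]; exact eq_neg_of_add_eq_zero_left h
  obtain ⟨n, hn⟩ := exp_eq_exp_iff_exists_int.1 h0
  have him := congrArg im hn
  simp only [add_im, mul_im, intCast_re, intCast_im, I_re, I_im] at him
  norm_num at him
  have hm := pole_im_mem hp
  have hw' : w.im ∈ Icc 0 (2 * Real.pi) := hw
  have hpi := Real.pi_pos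
  have h1 : (n : ℝ) < 1 := by
    by_contra hcon
    nlinarith [hw'.2, hm.1]
  have h2 : (-1 : ℝ) < n := by
    by_contra hcon
    nlinarith [hw'.1, hm.2]
  have : n = 0 := by
    have h3 : n < 1 := by exact_mod_cast h1
    have h4 : -1 < n := by exact_mod_cast h2
    omega
  subst this
  exact hne (by simpa using hn)

/-- `(H(w) - H(w₀) e^{w - w₀}) / (e^w + p)` with its singularity at `w₀ = pole p` removed. -/
noncomputable def regularPart (H : ℂ → ℂ) (p w : ℂ) : ℂ :=
  dslope (fun w => H w - H (pole p) * exp (-pole p) * exp w) (pole p) w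
    / dslope (fun w => exp w + p) (pole p) w

theorem regularPart_of_ne {H : ℂ → ℂ} {p w : ℂ} (hp : p ≠ 0) (hne : w ≠ pole p) :
    regularPart H p w =
      H w / (exp w + p) - H (pole p) * exp (-pole p) * (exp w / (exp w + p)) := by
  have h0 : w - pole p ≠ 0 := sub_ne_zero.2 hne
  have h1 : H (pole p) * exp (-pole p) * exp (pole p) = H (pole p) := by
    rw [mul_assoc, ← exp_add]; simp
  rw [regularPart, dslope_of_ne _ hne, dslope_of_ne _ hne, slope_def_field, slope_def_field, h1,
    exp_pole hp, div_div_div_cancel_right₀ h0]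
  simp only [sub_self, sub_zero, neg_add_cancel]
  ring

/-- Both divided differences are entire. The lower one equals `e^(pole p) ≠ 0` at the pole, and
elsewhere in the strip `e^w + p` does not vanish. -/
theorem differentiableOn_regularPart {H : ℂ → ℂ} (hH : Differentiable ℂ H) {p : ℂ}
    (hp : p ∈ slitPlane) : DifferentiableOn ℂ (regularPart H p) periodStrip := by
  have hd : ∀ f : ℂ → ℂ, Differentiable ℂ f → Differentiable ℂ (dslope f (pole p)) := fun f hf => by
    rw [← differentiableOn_univ, Complex.differentiableOn_dslope univ_mem]
    exact hf.differentiableOn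
  refine DifferentiableOn.div (hd _ (by fun_prop)).differentiableOn
    (hd _ (by fun_prop)).differentiableOn fun w hw => ?_
  rcases eq_or_ne w (pole p) with rfl | hne
  · rw [dslope_same]
    simp [exp_ne_zero]
  · rw [dslope_of_ne _ hne, slope_def_field]
    refine div_ne_zero ?_ (sub_ne_zero.2 hne)
    rw [exp_pole (slitPlane_ne_zero hp), neg_add_cancel, sub_zero]
    exact exp_add_ne_zero hp hw hne

theorem tendsto_exp_div_atTop (p : ℂ) :
    Tendsto (fun w => exp w / (exp w + p)) (comap re atTop) (𝓝 1) := by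
  have h1 : Tendsto (fun w => p * exp (-w)) (comap re atTop) (𝓝 0) := by
    rw [tendsto_zero_iff_norm_tendsto_zero]
    simp only [norm_mul, norm_exp, neg_re]
    have : Tendsto (fun w : ℂ => Real.exp (-w.re)) (comap re atTop) (𝓝 0) :=
      Real.tendsto_exp_neg_atTop_nhds_zero.comp tendsto_comap
    simpa using this.const_mul ‖p‖
  have h2 := (h1.const_add 1).inv₀ (by simp)
  simp only [add_zero, inv_one] at h2
  refine h2.congr fun w => ?_
  rw [exp_neg, ← one_div, ← mul_div_mul_left _ _ (exp_ne_zero w), mul_one, mul_add, mul_one,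
    mul_left_comm, mul_inv_cancel₀ (exp_ne_zero w), mul_one]

theorem tendsto_exp_div_atBot {p : ℂ} (hp : p ≠ 0) :
    Tendsto (fun w => exp w / (exp w + p)) (comap re atBot) (𝓝 0) := by
  have h1 : Tendsto exp (comap re atBot) (𝓝 0) := by
    rw [tendsto_zero_iff_norm_tendsto_zero]
    simp only [norm_exp]
    exact Real.tendsto_exp_atBot.comp tendsto_comap
  have h2 := h1.div (h1.add_const p) (by simpa using hp)
  rwa [zero_div] at h2

/-- Partial fractions, obtained from Lagrange interpolation of the constant `1` at the nodes `-p j`.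
-/
theorem inv_prod_add_eq_sum {ι : Type*} [DecidableEq ι] {S : Finset ι} (hS : S.Nonempty)
    {p : ι → ℂ} (hinj : Set.InjOn p S) {Y : ℂ} (hY : ∀ j ∈ S, Y + p j ≠ 0) :
    (∏ j ∈ S, (Y + p j))⁻¹ = ∑ j ∈ S, (∏ i ∈ S.erase j, (p i - p j))⁻¹ / (Y + p j) := by
  have hinj' : Set.InjOn (fun j => -p j) S := fun a ha b hb hab => hinj ha hb (neg_injective hab)
  have h := Lagrange.eval_interpolate_not_at_node (s := S) (v := fun j => -p j) (x := Y) 1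
    (fun i hi h => hY i hi (by rw [h]; ring))
  rw [Lagrange.interpolate_one hinj' hS, Polynomial.eval_one, Lagrange.eval_nodal] at h
  simp only [sub_neg_eq_add, Pi.one_apply, mul_one] at h
  rw [← eq_comm, ← mul_eq_one_iff_eq_inv₀ (Finset.prod_ne_zero_iff.2 hY), mul_comm, h]
  congr 1
  refine Finset.sum_congr rfl fun j _ => ?_
  rw [Lagrange.nodalWeight, div_eq_mul_inv, Finset.prod_inv_distrib]
  congr 2
  refine Finset.prod_congr rfl fun i _ => ?_
  ring

/-- Shifting the line of integration by the period `2πi` of the denominator picks up one residue for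
each of the points `p j`. -/
theorem integral_sub_integral_shift {ι : Type*} [DecidableEq ι] {S : Finset ι} (hS : S.Nonempty)
    {p : ι → ℂ} (hp : ∀ j ∈ S, p j ∈ slitPlane) (hinj : Set.InjOn p S)
    {H : ℂ → ℂ} (hH : Differentiable ℂ H)
    (hbot : Tendsto (fun w => H w * (∏ j ∈ S, (exp w + p j))⁻¹)
      (comap re atBot ⊓ 𝓟 periodStrip) (𝓝 0))
    (htop : Tendsto (fun w => H w * (∏ j ∈ S, (exp w + p j))⁻¹)
      (comap re atTop ⊓ 𝓟 periodStrip) (𝓝 0))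
    (hi0 : Integrable fun x : ℝ => H x * (∏ j ∈ S, (exp x + p j))⁻¹)
    (hi1 : Integrable fun x : ℝ =>
      H (x + 2 * Real.pi * I) * (∏ j ∈ S, (exp x + p j))⁻¹) :
    (∫ x : ℝ, H x * (∏ j ∈ S, (exp x + p j))⁻¹)
      - (∫ x : ℝ, H (x + 2 * Real.pi * I) * (∏ j ∈ S, (exp x + p j))⁻¹)
      = 2 * Real.pi * I * ∑ j ∈ S,
          (∏ i ∈ S.erase j, (p i - p j))⁻¹ * (H (pole (p j)) * exp (-pole (p j))) := by
  set f : ℂ → ℂ := fun w => H w * (∏ j ∈ S, (exp w + p j))⁻¹ with hf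
  set B : ι → ℂ := fun j =>
    (∏ i ∈ S.erase j, (p i - p j))⁻¹ * (H (pole (p j)) * exp (-pole (p j))) with hB
  -- `D` is `f` minus the periodic functions `B_j e^w/(e^w + p_j)` with the same residues. It is
  -- holomorphic on the strip, so Cauchy's theorem on rectangles replaces the residue theorem.
  set D : ℂ → ℂ := fun w => ∑ j ∈ S, (∏ i ∈ S.erase j, (p i - p j))⁻¹ * regularPart H (p j) w
    with hD
  have hper : ∀ x : ℂ, exp (x + 2 * Real.pi * I) = exp x := fun x => by rw [exp_add]; simp
  have hDd : DifferentiableOn ℂ D periodStrip :=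
    DifferentiableOn.fun_sum fun j hj => (differentiableOn_regularPart hH (hp j hj)).const_mul _
  have hDf : ∀ w ∈ periodStrip, (∀ j ∈ S, w ≠ pole (p j)) →
      D w = f w - ∑ j ∈ S, B j * (exp w / (exp w + p j)) := fun w hw hne => by
    simp only [hD, hf]
    rw [inv_prod_add_eq_sum hS hinj fun j hj => exp_add_ne_zero (hp j hj) hw (hne j hj),
      Finset.mul_sum, ← Finset.sum_sub_distrib]
    refine Finset.sum_congr rfl fun j hj => ?_
    rw [regularPart_of_ne (slitPlane_ne_zero (hp j hj)) (hne j hj), hB]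
    ring
  -- The subtracted terms are `2πi`-periodic and drop out of the difference of the horizontal edges.
  have hedge : ∀ x : ℝ, D x - D (x + 2 * Real.pi * I) = f x - f (x + 2 * Real.pi * I) := fun x => by
    have hpi := Real.pi_pos
    rw [hDf x (by simp [periodStrip, hpi.le]) fun j hj h => ?_,
      hDf (x + 2 * Real.pi * I) (by simp [periodStrip, hpi.le]) fun j hj h => ?_]
    · simp only [hper]; ring
    · have := congrArg im h
      have h2 := (pole_im_mem (hp j hj)).2
      simp at this
      linarith
    · have := congrArg im h
      have h2 := (pole_im_mem (hp j hj)).1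
      simp at this
      linarith
  have hfar : ∀ F : Filter ℝ, (∀ j ∈ S, ∀ᶠ R in F, R ≠ (pole (p j)).re) →
      ∀ᶠ w in comap re F ⊓ 𝓟 periodStrip,
        f w - ∑ j ∈ S, B j * (exp w / (exp w + p j)) = D w := fun F hF => by
    rw [eventually_inf_principal, eventually_comap]
    filter_upwards [(S.eventually_all).2 hF] with R hR w hw hws
    refine (hDf w hws fun j hj h => hR j hj ?_).symm
    rw [← hw, h]
  have hDbot : Tendsto D (comap re atBot ⊓ 𝓟 periodStrip) (𝓝 0) := by
    refine Tendsto.congr' (hfar atBot fun j _ => eventually_ne_atBot _) ?_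
    have : Tendsto (fun w => ∑ j ∈ S, B j * (exp w / (exp w + p j))) (comap re atBot) (𝓝 0) := by
      simpa using tendsto_finsetSum S fun j hj =>
        (tendsto_exp_div_atBot (slitPlane_ne_zero (hp j hj))).const_mul (B j)
    simpa using hbot.sub (this.mono_left inf_le_left)
  -- `e^w/(e^w + p)` tends to `0` on the left and to `1` on the right, so the right-hand vertical
  -- edge alone supplies the sum of residues.
  have hDtop : Tendsto D (comap re atTop ⊓ 𝓟 periodStrip) (𝓝 (-∑ j ∈ S, B j)) := by
    refine Tendsto.congr' (hfar atTop fun j _ => eventually_ne_atTop _) ?_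
    have : Tendsto (fun w => ∑ j ∈ S, B j * (exp w / (exp w + p j))) (comap re atTop)
        (𝓝 (∑ j ∈ S, B j)) := by
      simpa using tendsto_finsetSum S fun j hj => (tendsto_exp_div_atTop (p j)).const_mul (B j)
    simpa using htop.sub (this.mono_left inf_le_left)
  have hi1' : Integrable fun x : ℝ => f (x + 2 * Real.pi * I) := by
    simpa only [hf, hper] using hi1
  have hvt := tendsto_integral_vertical hDd.continuousOn hDtop
  have hvb := (tendsto_integral_vertical hDd.continuousOn hDbot).comp tendsto_neg_atTop_atBot
  have hh := intervalIntegral_tendsto_integral (hi0.sub hi1') tendsto_neg_atTop_atBot tendsto_id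
  have hrect : ∀ R : ℝ, (∫ x in (-R)..R, (f x - f (x + 2 * Real.pi * I)))
      + I * (∫ y : ℝ in (0)..(2 * Real.pi), D (R + y * I))
      - I * (∫ y : ℝ in (0)..(2 * Real.pi), D (((-R : ℝ) : ℂ) + y * I)) = 0 := fun R => by
    have hpi : (0 : ℝ) ≤ 2 * Real.pi := by positivity
    have hsub : (uIcc (-R) R ×ℂ uIcc 0 (2 * Real.pi)) ⊆ periodStrip := fun w hw => by
      have := hw.2
      rw [uIcc_of_le hpi] at this
      exact this
    have h := integral_boundary_rect_eq_zero_of_differentiableOn D (((-R : ℝ) : ℂ))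
      (R + ((2 * Real.pi : ℝ) : ℂ) * I) (by simpa using hDd.mono hsub)
    simp only [ofReal_re, ofReal_im, add_re, mul_re, I_re, mul_zero, I_im, mul_one, sub_self,
      add_zero, add_im, mul_im, zero_add, ofReal_zero, zero_mul, smul_eq_mul] at h
    have hseg : ∀ c ∈ Icc 0 (2 * Real.pi),
        IntervalIntegrable (fun x : ℝ => D (x + c * I)) volume (-R) R := fun c hc =>
      (hDd.continuousOn.comp_continuous (by fun_prop)
        fun x => by simpa [periodStrip] using hc).intervalIntegrable _ _
    have h0 := hseg 0 ⟨le_rfl, hpi⟩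
    have h2 := hseg (2 * Real.pi) ⟨hpi, le_rfl⟩
    simp only [ofReal_zero, zero_mul, add_zero] at h0
    rw [← intervalIntegral.integral_sub h0 h2] at h
    rw [← h]
    congr 3
    funext x
    rw [← hedge]
    push_cast
    rfl
  have hlim := (hh.add (hvt.const_mul I)).sub (hvb.const_mul I)
  have hzero := tendsto_nhds_unique hlim (tendsto_const_nhds.congr fun R => (hrect R).symm)
  have hsplit := integral_sub hi0 hi1'
  simp only [Pi.sub_apply] at hzero
  rw [hsplit] at hzero
  simp only [hf, hper] at hzero
  linear_combination hzero

end Lightning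

/-! ### Geometry of the sector and decay estimates -/

namespace Lightning

open Complex Filter Topology Set MeasureTheory

theorem norm_le_and_abs_arg_le_of_mem_sector {β : ℝ} (hβ : β < 2) {z : ℂ}
    (hz : z ∈ sector β) (h0 : z ≠ 0) : ‖z‖ ≤ 1 ∧ |arg z| ≤ β * Real.pi / 2 := by
  obtain ⟨x, hx, θ, hθ, h⟩ := hz
  have hx0 : 0 < x := by
    rcases hx.1.eq_or_lt with rfl | h'
    · rcases h with h | h <;> simp [h] at h0
    · exact h'
  have hpi := Real.pi_pos
  have h1 : θ * Real.pi / 2 < Real.pi := by nlinarith [hθ.2]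
  have h2 : 0 ≤ θ * Real.pi / 2 := by have := hθ.1; positivity
  have h3 : θ * Real.pi / 2 ≤ β * Real.pi / 2 := by have := hθ.2; gcongr
  have key : ∀ t : ℝ, |t| = θ * Real.pi / 2 →
      ‖(x : ℂ) * exp (t * I)‖ ≤ 1 ∧ |arg ((x : ℂ) * exp (t * I))| ≤ β * Real.pi / 2 := by
    intro t ht
    constructor
    · rw [norm_mul, norm_exp_ofReal_mul_I, mul_one, norm_real, Real.norm_of_nonneg hx.1]
      exact hx.2
    · have ht' : |t| < Real.pi := ht ▸ h1
      rw [exp_mul_I, arg_mul_cos_add_sin_mul_I hx0 ⟨(abs_lt.1 ht').1, (abs_lt.1 ht').2.le⟩, ht]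
      exact h3
  rcases h with rfl | rfl
  · exact key _ (abs_of_nonneg h2)
  · rw [← neg_mul, ← ofReal_neg]
    exact key _ (by rw [abs_neg, abs_of_nonneg h2])

theorem varkappa_pos {β : ℝ} (hβ : β < 2) : 0 < varkappa β := by
  unfold varkappa
  split_ifs with h
  · exact one_pos
  · have := Real.pi_pos
    apply Real.sin_pos_of_pos_of_lt_pi <;> nlinarith

theorem varkappa_le_one (β : ℝ) : varkappa β ≤ 1 := by
  unfold varkappa
  split_ifs with h
  · exact le_rfl
  · exact Real.sin_le_one _

/-- `|y + z|² = y² + 2y|z| cos φ + |z|²`. If `cos φ ≥ 0`, it dominates both squares; otherwise it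
equals `sin² φ · max²` plus a perfect square, and `sin φ ≥ sin(βπ/2)`. -/
theorem varkappa_mul_max_le {β : ℝ} (hβ : β < 2) {z : ℂ} (hz : |arg z| ≤ β * Real.pi / 2)
    {y : ℝ} (hy : 0 ≤ y) : varkappa β * max y ‖z‖ ≤ ‖(y : ℂ) + z‖ := by
  have hpi := Real.pi_pos
  have hk := varkappa_pos hβ
  have hre : z.re = ‖z‖ * Real.cos |arg z| := by rw [Real.cos_abs, norm_mul_cos_arg]
  have hn : ‖(y : ℂ) + z‖ ^ 2 = y ^ 2 + 2 * y * z.re + ‖z‖ ^ 2 := by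
    rw [← normSq_eq_norm_sq, ← normSq_eq_norm_sq, normSq_apply, normSq_apply]
    simp
    ring
  refine le_of_sq_le_sq ?_ (norm_nonneg _)
  rw [hn, hre]
  have hr := norm_nonneg z
  rcases le_or_gt |arg z| (Real.pi / 2) with h | h
  · have hc : 0 ≤ Real.cos |arg z| :=
      Real.cos_nonneg_of_neg_pi_div_two_le_of_le (by linarith [abs_nonneg (arg z)]) h
    have h1 : varkappa β * max y ‖z‖ ≤ max y ‖z‖ :=
      mul_le_of_le_one_left (le_max_of_le_left hy) (varkappa_le_one β)
    have h2 : (varkappa β * max y ‖z‖) ^ 2 ≤ (max y ‖z‖) ^ 2 := by gcongr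
    refine h2.trans ?_
    have h3 : 0 ≤ y * (‖z‖ * Real.cos |arg z|) := by positivity
    rcases max_cases y ‖z‖ with h | h <;> rw [h.1] <;> nlinarith [sq_nonneg y, sq_nonneg ‖z‖]
  · have hβ1 : ¬ β ≤ 1 := by
      intro hb
      nlinarith
    have h1 : varkappa β ≤ Real.sin |arg z| := by
      rw [varkappa, if_neg hβ1, ← Real.sin_pi_sub (β * Real.pi / 2), ← Real.sin_pi_sub |arg z|]
      apply Real.sin_le_sin_of_le_of_le_pi_div_two <;> nlinarith
    have h2 : (varkappa β * max y ‖z‖) ^ 2 ≤ (Real.sin |arg z| * max y ‖z‖) ^ 2 := by gcongr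
    refine h2.trans ?_
    have h3 := Real.sin_sq_add_cos_sq |arg z|
    set S := Real.sin |arg z|
    set c := Real.cos |arg z|
    rcases max_cases y ‖z‖ with h | h <;> rw [h.1, mul_pow]
    · have : y ^ 2 + 2 * y * (‖z‖ * c) + ‖z‖ ^ 2 - S ^ 2 * y ^ 2 = (‖z‖ + y * c) ^ 2 := by
        linear_combination (y ^ 2) * (-h3)
      nlinarith [sq_nonneg (‖z‖ + y * c)]
    · have : y ^ 2 + 2 * y * (‖z‖ * c) + ‖z‖ ^ 2 - S ^ 2 * ‖z‖ ^ 2 = (y + ‖z‖ * c) ^ 2 := by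
        linear_combination (‖z‖ ^ 2) * (-h3)
      nlinarith [sq_nonneg (y + ‖z‖ * c)]

/-- The majorant `(|x| + B)^l e^{-a|x|}`. -/
noncomputable def majorant (B : ℝ) (l : ℕ) (a x : ℝ) : ℝ := (|x| + B) ^ l * Real.exp (-(a * |x|))

theorem majorant_nonneg {B : ℝ} (hB : 0 ≤ B) (l : ℕ) (a x : ℝ) : 0 ≤ majorant B l a x := by
  unfold majorant; positivity

theorem integrableOn_and_integral_mul_exp {a : ℝ} (ha : 0 < a) :
    IntegrableOn (fun t : ℝ => t * Real.exp (-(a * t))) (Ioi 0) ∧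
      ∫ t in Ioi (0 : ℝ), t * Real.exp (-(a * t)) = 1 / a ^ 2 := by
  have h := Real.integral_rpow_mul_exp_neg_mul_Ioi (a := 2) two_pos ha
  norm_num at h
  have h2 := integrableOn_rpow_mul_exp_neg_mul_rpow (p := 1) (s := 1) (b := a)
    (by norm_num) one_pos ha
  norm_num at h2
  refine ⟨h2, by rw [h, one_div]⟩

theorem integrableOn_and_integral_exp {a : ℝ} (ha : 0 < a) :
    IntegrableOn (fun t : ℝ => Real.exp (-(a * t))) (Ioi 0) ∧
      ∫ t in Ioi (0 : ℝ), Real.exp (-(a * t)) = 1 / a := by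
  have h := integral_exp_mul_Ioi (a := -a) (by linarith) 0
  have h2 := integrableOn_exp_mul_Ioi (a := -a) (by linarith) 0
  simp only [neg_mul] at h h2
  refine ⟨h2, by rw [h]; simp⟩

theorem integrable_comp_abs {f : ℝ → ℝ} (hf : IntegrableOn f (Ioi 0)) :
    Integrable fun x : ℝ => f |x| := by
  have h1 : IntegrableOn (fun x => f |x|) (Ioi 0) :=
    hf.congr_fun (fun x hx => by rw [abs_of_pos hx]) measurableSet_Ioi
  have h2 : IntegrableOn (fun x => f |x|) (Iic 0) := by
    rw [← Measure.map_neg_eq_self (volume : Measure ℝ)]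
    let m : MeasurableEmbedding fun x : ℝ => -x := (Homeomorph.neg ℝ).measurableEmbedding
    rw [m.integrableOn_map_iff]
    simp_rw [Function.comp_def, abs_neg, neg_preimage, neg_Iic, neg_zero]
    exact Iff.mpr integrableOn_Ici_iff_integrableOn_Ioi h1
  have := h2.union h1
  rwa [Iic_union_Ioi, integrableOn_univ] at this

theorem integrable_majorant_and_integral_le {B a : ℝ} (hB : 0 ≤ B) (ha : 0 < a) {l : ℕ}
    (hl : l = 0 ∨ l = 1) : Integrable (majorant B l a) ∧
      ∫ x, majorant B l a x ≤ 2 * (1 + B * a) / a ^ (l + 1) := by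
  obtain ⟨i0, e0⟩ := integrableOn_and_integral_exp ha
  obtain ⟨i1, e1⟩ := integrableOn_and_integral_mul_exp ha
  rcases hl with rfl | rfl
  · have h : majorant B 0 a = fun x => (fun t : ℝ => Real.exp (-(a * t))) |x| := by
      funext x; simp [majorant]
    refine ⟨h ▸ integrable_comp_abs i0, ?_⟩
    rw [h, integral_comp_abs (f := fun t : ℝ => Real.exp (-(a * t))), e0, zero_add, pow_one,
      mul_div_assoc]
    have : 0 ≤ B * a := by positivity
    gcongr
    linarith
  · have h : majorant B 1 a = fun x =>
        (fun t : ℝ => t * Real.exp (-(a * t)) + B * Real.exp (-(a * t))) |x| := by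
      funext x; simp [majorant]; ring
    have i2 := i1.add (i0.const_mul B)
    refine ⟨h ▸ integrable_comp_abs i2, ?_⟩
    rw [h, integral_comp_abs (f := fun t : ℝ => t * Real.exp (-(a * t)) + B * Real.exp (-(a * t))),
      integral_add i1 (i0.const_mul B), integral_const_mul, e0, e1]
    refine le_of_eq ?_
    field_simp

theorem tendsto_majorant {B σ : ℝ} (hσ : 0 < σ) {l : ℕ} (hl : l = 0 ∨ l = 1) {F : Filter ℝ}
    (hF : Tendsto (fun x => |x|) F atTop) : Tendsto (majorant B l σ) F (𝓝 0) := by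
  have h0 := (tendsto_rpow_mul_exp_neg_mul_atTop_nhds_zero 0 σ hσ).comp hF
  have h1 := (tendsto_rpow_mul_exp_neg_mul_atTop_nhds_zero 1 σ hσ).comp hF
  simp only [Function.comp_def, Real.rpow_zero, Real.rpow_one, one_mul, neg_mul] at h0 h1
  rcases hl with rfl | rfl
  · exact h0.congr fun x => by simp [majorant]
  · have := h1.add (h0.const_mul B)
    simp only [mul_zero, add_zero] at this
    refine this.congr fun x => ?_
    simp [majorant]; ring

/-- The entire numerator `(w - c)^l e^{sw}`. -/
noncomputable def numer (c : ℝ) (l : ℕ) (s w : ℂ) : ℂ := (w - c) ^ l * exp (s * w)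

theorem differentiable_numer (c : ℝ) (l : ℕ) (s : ℂ) : Differentiable ℂ (numer c l s) := by
  unfold numer; fun_prop

theorem norm_numer_le (c : ℝ) (l : ℕ) (s w : ℂ) {B : ℝ} (hB : |c| + |w.im| ≤ B) :
    ‖numer c l s w‖ ≤ (|w.re| + B) ^ l * Real.exp (s.re * w.re - s.im * w.im) := by
  rw [numer, norm_mul, norm_pow, norm_exp, mul_re]
  have h1 : ‖w - c‖ ≤ |w.re| + B := by
    refine (norm_sub_le _ _).trans ?_
    have := norm_le_abs_re_add_abs_im w
    rw [norm_real, Real.norm_eq_abs]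
    linarith
  gcongr

/-- On the strip the factor `e^(-Im s · Im w)` is bounded, so decay in `Re w` alone decides. -/
theorem tendsto_numer {c : ℝ} {l : ℕ} (hl : l = 0 ∨ l = 1) {s : ℂ} {σ : ℝ} (hσ : 0 < σ)
    {F : Filter ℝ} (hF : Tendsto (fun x => |x|) F atTop) (hs : ∀ᶠ x in F, s.re * x ≤ -(σ * |x|)) :
    Tendsto (numer c l s) (comap re F ⊓ 𝓟 periodStrip) (𝓝 0) := by
  set B := |c| + 2 * Real.pi
  have h1 : Tendsto (fun w : ℂ => majorant B l σ w.re * Real.exp (2 * Real.pi * |s.im|))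
      (comap re F ⊓ 𝓟 periodStrip) (𝓝 0) := by
    have := (((tendsto_majorant (B := B) hσ hl hF).comp (tendsto_comap (f := re))).mul_const
      (Real.exp (2 * Real.pi * |s.im|))).mono_left (inf_le_left (b := 𝓟 periodStrip))
    simpa only [zero_mul, Function.comp_def] using this
  refine squeeze_zero_norm' ?_ h1
  rw [eventually_inf_principal, eventually_comap]
  filter_upwards [hs] with x hx w hw hws
  have him : w.im ∈ Icc 0 (2 * Real.pi) := hws
  have h2 : |w.im| ≤ 2 * Real.pi := by rw [abs_of_nonneg him.1]; exact him.2
  refine (norm_numer_le c l s w (B := B) (by simp only [B]; linarith)).trans ?_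
  rw [majorant, mul_assoc, ← Real.exp_add]
  have hB0 : 0 ≤ |w.re| + B := by simp only [B]; have := Real.pi_pos; positivity
  have h3 : |s.im * w.im| ≤ |s.im| * (2 * Real.pi) := by rw [abs_mul]; gcongr
  have h4 := neg_abs_le (s.im * w.im)
  gcongr
  subst hw
  linarith

theorem tendsto_numer_mul_inv_prod {ι : Type*} {S : Finset ι} {p : ι → ℂ} (hp : ∀ j ∈ S, p j ≠ 0)
    {c : ℝ} {l : ℕ} (hl : l = 0 ∨ l = 1) {s : ℂ} (h0 : 0 < s.re) (h1 : s.re < S.card) :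
    Tendsto (fun w => numer c l s w * (∏ j ∈ S, (exp w + p j))⁻¹)
      (comap re atBot ⊓ 𝓟 periodStrip) (𝓝 0) ∧
    Tendsto (fun w => numer c l s w * (∏ j ∈ S, (exp w + p j))⁻¹)
      (comap re atTop ⊓ 𝓟 periodStrip) (𝓝 0) := by
  constructor
  · have hexp : Tendsto exp (comap re atBot) (𝓝 0) := by
      rw [tendsto_zero_iff_norm_tendsto_zero]
      simp only [norm_exp]
      exact Real.tendsto_exp_atBot.comp tendsto_comap
    have h2 : Tendsto (fun w => (∏ j ∈ S, (exp w + p j))⁻¹) (comap re atBot)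
        (𝓝 (∏ j ∈ S, (0 + p j))⁻¹) :=
      (tendsto_finsetProd S fun j _ => hexp.add_const (p j)).inv₀
        (Finset.prod_ne_zero_iff.2 fun j hj => by simpa using hp j hj)
    have h3 := (tendsto_numer (c := c) hl h0 tendsto_abs_atBot_atTop (s := s) ?_).mul
      (h2.mono_left (inf_le_left (b := 𝓟 periodStrip)))
    · simpa using h3
    · filter_upwards [eventually_le_atBot 0] with x hx
      rw [abs_of_nonpos hx]; linarith
  · have h2 : Tendsto (fun w => ∏ j ∈ S, (exp w / (exp w + p j))) (comap re atTop) (𝓝 1) := by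
      simpa using tendsto_finsetProd S fun j _ => tendsto_exp_div_atTop (p j)
    -- On the right, `e^(-card · w)` from the denominator is moved into the exponent of the
    -- numerator, leaving a quotient that tends to `1`.
    have h3 := (tendsto_numer (c := c) hl (σ := S.card - s.re) (by linarith)
      tendsto_abs_atTop_atTop (s := s - S.card) ?_).mul
      (h2.mono_left (inf_le_left (b := 𝓟 periodStrip)))
    · rw [zero_mul] at h3
      refine h3.congr fun w => ?_
      rw [Finset.prod_div_distrib, Finset.prod_const, numer, numer, sub_mul, exp_sub, ← exp_nat_mul]
      field_simp
    · filter_upwards [eventually_ge_atTop 0] with x hx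
      rw [abs_of_nonneg hx, sub_re, natCast_re]; linarith

end Lightning

/-! ### Line integrals and residues of the kernel -/

namespace Lightning

open Complex Filter Topology Set MeasureTheory

/-- The points `z, s_1, …, s_ℓ`, indexed by `0, 1, …, ℓ`. -/
noncomputable def polePoint (ℓ : ℕ) (z : ℂ) (k : ℕ) : ℂ := if k = 0 then z else node ℓ k

/-- The index set of `polePoint`. -/
def poleIndex (ℓ : ℕ) : Finset ℕ := insert 0 (Finset.Icc 1 ℓ)

theorem polePoint_of_mem {ℓ k : ℕ} (z : ℂ) (hk : k ∈ Finset.Icc 1 ℓ) :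
    polePoint ℓ z k = node ℓ k := by
  have := Finset.mem_Icc.1 hk
  rw [polePoint, if_neg (by omega)]

theorem card_poleIndex (ℓ : ℕ) : (poleIndex ℓ).card = ℓ + 1 := by
  rw [poleIndex, Finset.card_insert_of_notMem (by simp)]; simp

theorem prod_poleIndex (ℓ : ℕ) (z : ℂ) (f : ℂ → ℂ) :
    ∏ j ∈ poleIndex ℓ, f (polePoint ℓ z j) = f z * ∏ k ∈ Finset.Icc 1 ℓ, f (node ℓ k) := by
  rw [poleIndex, Finset.prod_insert (by simp)]
  congr 1
  exact Finset.prod_congr rfl fun k hk => by rw [polePoint_of_mem z hk]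

/-- The numerator `z ∏ (z - s_k)`. -/
noncomputable def nodeFactor (ℓ : ℕ) (z : ℂ) : ℂ := z * ∏ k ∈ Finset.Icc 1 ℓ, (z - node ℓ k)

theorem mem_slitPlane_of_abs_arg_le {β : ℝ} (hβ : β < 2) {z : ℂ} (h0 : z ≠ 0)
    (hz : |arg z| ≤ β * Real.pi / 2) : z ∈ slitPlane := by
  rw [mem_slitPlane_iff_arg]
  refine ⟨fun h => ?_, h0⟩
  rw [h, abs_of_pos Real.pi_pos] at hz
  nlinarith [Real.pi_pos]

theorem polePoint_mem_slitPlane {ℓ : ℕ} {z : ℂ} (hz : z ∈ slitPlane) :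
    ∀ j ∈ poleIndex ℓ, polePoint ℓ z j ∈ slitPlane := by
  intro j _
  unfold polePoint
  split_ifs
  · exact hz
  · exact ofReal_mem_slitPlane.2 (node_pos ℓ j)

theorem polePoint_injOn {ℓ : ℕ} {z : ℂ} (hne : ∀ k ∈ Finset.Icc 1 ℓ, z ≠ node ℓ k) :
    Set.InjOn (polePoint ℓ z) (poleIndex ℓ) := by
  intro a ha b hb hab
  rw [poleIndex, Finset.mem_coe, Finset.mem_insert] at ha hb
  rcases ha with rfl | ha <;> rcases hb with rfl | hb
  · rfl
  · rw [polePoint_of_mem z hb] at hab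
    exact absurd hab (hne b hb)
  · rw [polePoint_of_mem z ha] at hab
    exact absurd hab.symm (hne a ha)
  · rw [polePoint_of_mem z ha, polePoint_of_mem z hb, ofReal_inj] at hab
    exact node_injOn ℓ ha hb hab

theorem exp_real_add_ne_zero {p : ℂ} (hp : p ∈ slitPlane) (x : ℝ) : exp (x : ℂ) + p ≠ 0 := by
  refine exp_add_ne_zero hp (by simp [periodStrip, Real.pi_pos.le]) fun h => ?_
  have := congrArg im h
  have h2 := (pole_im_mem hp).1
  simp at this
  linarith

section Kernel

variable {β q α c B : ℝ} {ℓ l : ℕ} {z : ℂ}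

/-- For `x ≤ 0` the sector bound is used with `|z|`, cancelling the factor `z`; for `x > 0` it is
used with `e^x`, which supplies one more power of decay besides the `ℓ` from the nodes. -/
theorem norm_nodeFactor_mul_inv_le (hβ : β < 2) (hz : |arg z| ≤ β * Real.pi / 2) (h0 : z ≠ 0) (hz1 : ‖z‖ ≤ 1)
    (hN : NodeBounds q ℓ z) (hq : 1 ≤ q) (x : ℝ) :
    ‖nodeFactor ℓ z * (∏ j ∈ poleIndex ℓ, (exp x + polePoint ℓ z j))⁻¹‖ ≤
      q ^ ℓ / varkappa β * (if x ≤ 0 then 1 else Real.exp (-((ℓ + 1) * x))) := by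
  have hk := varkappa_pos hβ
  have hex := Real.exp_pos x
  have hzn : 0 < ‖z‖ := norm_pos_iff.2 h0
  have hmax := varkappa_mul_max_le hβ hz hex.le
  rw [ofReal_exp] at hmax
  have hden : 0 < ‖exp x + z‖ := lt_of_lt_of_le (by positivity) hmax
  have hprod : ∏ k ∈ Finset.Icc 1 ℓ, ‖z - node ℓ k‖ / ‖exp x + node ℓ k‖
      = ∏ k ∈ Finset.Icc 1 ℓ, ‖z - node ℓ k‖ / (Real.exp x + node ℓ k) := by
    refine Finset.prod_congr rfl fun k _ => ?_
    rw [← ofReal_exp, ← ofReal_add, norm_real, Real.norm_of_nonneg]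
    have := node_pos ℓ k
    positivity
  have hprod0 : 0 ≤ ∏ k ∈ Finset.Icc 1 ℓ, ‖z - node ℓ k‖ / (Real.exp x + node ℓ k) :=
    Finset.prod_nonneg fun k _ => by have := node_pos ℓ k; positivity
  have heq : ‖nodeFactor ℓ z * (∏ j ∈ poleIndex ℓ, (exp x + polePoint ℓ z j))⁻¹‖
      = ‖z‖ / ‖exp x + z‖ * ∏ k ∈ Finset.Icc 1 ℓ, ‖z - node ℓ k‖ / (Real.exp x + node ℓ k) := by
    rw [prod_poleIndex ℓ z (fun p => exp x + p), nodeFactor, ← hprod, Finset.prod_div_distrib,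
      norm_mul, norm_inv, norm_mul, norm_mul, norm_prod, norm_prod]
    simp only [div_eq_mul_inv, mul_inv]
    ring
  rw [heq]
  split_ifs with hx
  · have h1 : ‖z‖ / ‖exp x + z‖ ≤ 1 / varkappa β := by
      rw [div_le_div_iff₀ hden hk, one_mul, mul_comm]
      exact le_trans (by gcongr; exact le_max_right _ _) hmax
    calc _ ≤ 1 / varkappa β * q ^ ℓ :=
          mul_le_mul h1 (hN.small _ hex (Real.exp_le_one_iff.2 hx)) hprod0 (by positivity)
      _ = _ := by ring
  · have h1 : ‖z‖ / ‖exp x + z‖ ≤ 1 / (varkappa β * Real.exp x) := by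
      gcongr
      exact le_trans (by gcongr; exact le_max_left _ _) hmax
    have h2 : Real.exp (-((ℓ + 1) * x)) = (Real.exp x ^ ℓ)⁻¹ * (Real.exp x)⁻¹ := by
      rw [← Real.exp_nat_mul, ← Real.exp_neg, ← Real.exp_neg, ← Real.exp_add]
      ring_nf
    calc _ ≤ 1 / (varkappa β * Real.exp x) * (q ^ ℓ * (Real.exp x ^ ℓ)⁻¹) :=
          mul_le_mul h1 (hN.large _ (Real.one_le_exp (not_le.1 hx).le)) hprod0 (by positivity)
      _ = _ := by
          rw [h2]
          field_simp

theorem norm_kernel_le (hβ : β < 2) (hz : |arg z| ≤ β * Real.pi / 2) (h0 : z ≠ 0) (hz1 : ‖z‖ ≤ 1)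
    (hN : NodeBounds q ℓ z) (hq : 1 ≤ q) {s : ℂ} (hs : s.re = α) {τ : ℝ} (hB : |c| + |τ| ≤ B)
    (x : ℝ) :
    ‖nodeFactor ℓ z * (numer c l s (x + τ * I) *
        (∏ j ∈ poleIndex ℓ, (exp x + polePoint ℓ z j))⁻¹)‖ ≤
      q ^ ℓ / varkappa β * Real.exp (-(s.im * τ)) *
        (majorant B l α x + majorant B l (ℓ + 1 - α) x) := by
  have hk := varkappa_pos hβ
  have hB0 : 0 ≤ B := le_trans (by positivity) hB
  have h1 := norm_nodeFactor_mul_inv_le hβ hz h0 hz1 hN hq x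
  have h2 := norm_numer_le c l s (x + τ * I) (B := B) (by simpa using hB)
  simp only [add_re, ofReal_re, mul_re, I_re, mul_zero, ofReal_im, I_im, mul_one, sub_self,
    add_zero, add_im, mul_im, zero_add, hs] at h2
  rw [mul_left_comm, norm_mul]
  have hm1 := majorant_nonneg hB0 l α x
  have hm2 := majorant_nonneg hB0 l (ℓ + 1 - α) x
  refine (mul_le_mul h2 h1 (norm_nonneg _) (by positivity)).trans ?_
  split_ifs with hx
  · calc _ = q ^ ℓ / varkappa β * Real.exp (-(s.im * τ)) * majorant B l α x := by
          rw [majorant, abs_of_nonpos hx, sub_eq_add_neg, Real.exp_add]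
          ring_nf
      _ ≤ _ := by
          gcongr
          linarith
  · calc _ = q ^ ℓ / varkappa β * Real.exp (-(s.im * τ)) * majorant B l (ℓ + 1 - α) x := by
          rw [majorant, abs_of_pos (not_le.1 hx), sub_eq_add_neg, Real.exp_add,
            show -((ℓ + 1 - α) * x) = α * x + -((ℓ + 1) * x) by ring, Real.exp_add]
          ring
      _ ≤ _ := by
          gcongr
          linarith

theorem continuous_kernel (hz : z ∈ slitPlane) (s : ℂ) (τ : ℝ) :
    Continuous fun x : ℝ => numer c l s (x + τ * I) *
        (∏ j ∈ poleIndex ℓ, (exp x + polePoint ℓ z j))⁻¹ := by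
  refine Continuous.mul ((differentiable_numer c l s).continuous.comp (by fun_prop)) ?_
  refine Continuous.inv₀ (by fun_prop) fun x => ?_
  exact Finset.prod_ne_zero_iff.2 fun j hj =>
    exp_real_add_ne_zero (polePoint_mem_slitPlane hz j hj) x

theorem nodeFactor_ne_zero (h0 : z ≠ 0) (hne : ∀ k ∈ Finset.Icc 1 ℓ, z ≠ node ℓ k) :
    nodeFactor ℓ z ≠ 0 :=
  mul_ne_zero h0 (Finset.prod_ne_zero_iff.2 fun k hk => sub_ne_zero.2 (hne k hk))

/-- The two half-lines contribute about `α^(-(l+1))` and `(ℓ+1-α)^(-(l+1))`; after multiplication by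
`α^(l+1)` these become `1` and `κ^(l+1)`. -/
theorem integrable_kernel_and_integral_le (hβ : β < 2) (hz : |arg z| ≤ β * Real.pi / 2)
    (h0 : z ≠ 0) (hz1 : ‖z‖ ≤ 1) (hN : NodeBounds q ℓ z) (hq : 1 ≤ q) (hα : 0 < α) (hlo : α < ℓ + 1)
    (hhi : (ℓ : ℝ) < α + 1)
    (hl : l = 0 ∨ l = 1) {s : ℂ} (hs : s.re = α) {τ : ℝ} (hB : |c| + |τ| ≤ B) :
    Integrable (fun x : ℝ => nodeFactor ℓ z * (numer c l s (x + τ * I) *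
        (∏ j ∈ poleIndex ℓ, (exp x + polePoint ℓ z j))⁻¹)) ∧
    α ^ (l + 1) * ‖∫ x : ℝ, nodeFactor ℓ z * (numer c l s (x + τ * I) *
        (∏ j ∈ poleIndex ℓ, (exp x + polePoint ℓ z j))⁻¹)‖ ≤
      q ^ ℓ / varkappa β * Real.exp (-(s.im * τ)) *
        (4 * (1 + B) * (1 + α) * (1 + kappa α ℓ ^ (l + 1))) := by
  have hk := varkappa_pos hβ
  have hB0 : 0 ≤ B := le_trans (by positivity) hB
  obtain ⟨i1, e1⟩ := integrable_majorant_and_integral_le hB0 hα hl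
  obtain ⟨i2, e2⟩ := integrable_majorant_and_integral_le hB0 (sub_pos.2 hlo) hl
  have hbd := norm_kernel_le (c := c) (l := l) hβ hz h0 hz1 hN hq hs hB
  have hi := (i1.add i2).const_mul (q ^ ℓ / varkappa β * Real.exp (-(s.im * τ)))
  have hint : Integrable (fun x : ℝ => nodeFactor ℓ z * (numer c l s (x + τ * I) *
        (∏ j ∈ poleIndex ℓ, (exp x + polePoint ℓ z j))⁻¹)) :=
    hi.mono' ((continuous_const.mul (continuous_kernel
      (mem_slitPlane_of_abs_arg_le hβ h0 hz) s τ)).aestronglyMeasurable)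
      (Eventually.of_forall hbd)
  refine ⟨hint, ?_⟩
  have h3 := (norm_integral_le_integral_norm _).trans (integral_mono hint.norm hi hbd)
  have hsum : ∫ x, q ^ ℓ / varkappa β * Real.exp (-(s.im * τ)) *
      (majorant B l α + majorant B l (ℓ + 1 - α)) x = q ^ ℓ / varkappa β *
        Real.exp (-(s.im * τ)) * ((∫ x, majorant B l α x) + ∫ x, majorant B l (ℓ + 1 - α) x) := by
    rw [integral_const_mul]
    simp only [Pi.add_apply]
    rw [integral_add i1 i2]
  rw [hsum] at h3
  set d := (ℓ : ℝ) + 1 - α with hd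
  have hd0 : 0 < d := sub_pos.2 hlo
  have hkap : kappa α ℓ = α / d := rfl
  calc _ ≤ α ^ (l + 1) * (q ^ ℓ / varkappa β * Real.exp (-(s.im * τ)) *
        (2 * (1 + B * α) / α ^ (l + 1) + 2 * (1 + B * d) / d ^ (l + 1))) := by
        gcongr
        exact h3.trans (by gcongr)
    _ = q ^ ℓ / varkappa β * Real.exp (-(s.im * τ)) *
        (2 * (1 + B * α) + 2 * (1 + B * d) * kappa α ℓ ^ (l + 1)) := by
        rw [hkap, div_pow]
        field_simp
    _ ≤ _ := by
        have hkp : 0 ≤ kappa α ℓ ^ (l + 1) := by rw [hkap]; positivity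
        have hd2 : d ≤ 2 := by simp only [d]; linarith
        have : 0 ≤ B * α := by positivity
        have h5 : 2 * (1 + B * α) ≤ 4 * (1 + B) * (1 + α) := by nlinarith
        have h6 : 2 * (1 + B * d) ≤ 4 * (1 + B) * (1 + α) := by nlinarith
        have h7 := mul_le_mul_of_nonneg_right h6 hkp
        gcongr
        linarith

/-- The residue at `pole (polePoint ℓ z j)` of the integrand, up to sign. -/
noncomputable def residue (c : ℝ) (l : ℕ) (s : ℂ) (ℓ : ℕ) (z : ℂ) (j : ℕ) : ℂ :=
  nodeFactor ℓ z * ((∏ i ∈ (poleIndex ℓ).erase j, (polePoint ℓ z i - polePoint ℓ z j))⁻¹ *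
    (numer c l s (pole (polePoint ℓ z j)) * exp (-pole (polePoint ℓ z j))))

theorem norm_exp_neg_pole {p : ℂ} (hp : p ≠ 0) : ‖exp (-pole p)‖ = ‖p‖⁻¹ := by
  rw [exp_neg, exp_pole hp, norm_inv, norm_neg]

theorem norm_numer_pole_le {p : ℂ} (hp : p ≠ 0) (hB : |c| + 2 * Real.pi ≤ B) {s : ℂ}
    (hs : s.re = α) : ‖numer c l s (pole p)‖ ≤
      (|Real.log ‖p‖| + B) ^ l * (‖p‖ ^ α * Real.exp (-(s.im * (arg p + Real.pi)))) := by
  have h1 : |(pole p).im| ≤ 2 * Real.pi := by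
    rw [pole_im, abs_of_nonneg (by linarith [neg_pi_lt_arg p])]
    linarith [arg_le_pi p]
  refine (norm_numer_le c l s (pole p) (B := B) (by linarith)).trans (le_of_eq ?_)
  rw [pole_re, pole_im, Real.rpow_def_of_pos (norm_pos_iff.2 hp), ← Real.exp_add, hs]
  ring_nf

/-- The factor `z ∏ (z - s_k)` cancels exactly against `e^(-pole z)` and the differences of poles,
so only the numerator at the pole remains. -/
theorem norm_residue_zero_le (hz : |arg z| ≤ β * Real.pi / 2) (h0 : z ≠ 0) (hz1 : ‖z‖ ≤ 1)
    (hne : ∀ k ∈ Finset.Icc 1 ℓ, z ≠ node ℓ k) (hα : 0 < α) (hl : l = 0 ∨ l = 1)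
    (hB : |c| + 2 * Real.pi ≤ B) {s : ℂ} (hs : s.re = α) (ha : 0 ≤ s.im) :
    α ^ (l + 1) * ‖residue c l s ℓ z 0‖ ≤
      (1 + B) * (1 + α) ^ 2 * Real.exp (-((2 - β) * Real.pi / 2 * s.im)) := by
  have hB0 : 0 ≤ B := le_trans (by have := Real.pi_pos; positivity) hB
  have hzn : 0 < ‖z‖ := norm_pos_iff.2 h0
  have hp0 : polePoint ℓ z 0 = z := by simp [polePoint]
  have herase : (poleIndex ℓ).erase 0 = Finset.Icc 1 ℓ := by
    rw [poleIndex, Finset.erase_insert (by simp)]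
  have hprod : ∏ i ∈ Finset.Icc 1 ℓ, ‖polePoint ℓ z i - z‖ =
      ∏ i ∈ Finset.Icc 1 ℓ, ‖z - node ℓ i‖ :=
    Finset.prod_congr rfl fun k hk => by rw [polePoint_of_mem z hk, norm_sub_rev]
  have hprodne : ∏ i ∈ Finset.Icc 1 ℓ, ‖z - node ℓ i‖ ≠ 0 :=
    Finset.prod_ne_zero_iff.2 fun k hk => norm_ne_zero_iff.2 (sub_ne_zero.2 (hne k hk))
  have hres : ‖residue c l s ℓ z 0‖ = ‖numer c l s (pole z)‖ := by
    rw [residue, hp0, herase, nodeFactor, norm_mul, norm_mul, norm_mul, norm_mul,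
      norm_exp_neg_pole h0, norm_inv, norm_prod, norm_prod, hprod]
    field_simp
  rw [hres]
  have h1 := norm_numer_pole_le (l := l) h0 hB hs
  have h2 : Real.exp (-(s.im * (arg z + Real.pi))) ≤
      Real.exp (-((2 - β) * Real.pi / 2 * s.im)) := by
    have := (abs_le.1 hz).1
    rw [Real.exp_le_exp, neg_le_neg_iff, mul_comm]
    exact mul_le_mul_of_nonneg_left (by linarith) ha
  have hpow : ‖z‖ ^ α ≤ 1 := Real.rpow_le_one hzn.le hz1 hα.le
  have hpow0 : 0 ≤ ‖z‖ ^ α := by positivity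
  have h3 : α ^ (l + 1) * ((|Real.log ‖z‖| + B) ^ l * ‖z‖ ^ α) ≤ (1 + B) * (1 + α) ^ 2 := by
    rcases hl with rfl | rfl
    · simp only [zero_add, pow_one, pow_zero, one_mul]
      nlinarith [mul_nonneg hB0 hα.le, mul_nonneg hB0 (sq_nonneg (1 + α)), sq_nonneg α]
    -- This is `t e^(-t) ≤ 1` with `t = -α log ‖z‖`; it keeps the logarithm harmless as `z → 0`.
    · have h4 : α * |Real.log ‖z‖| * ‖z‖ ^ α ≤ 1 := by
        rw [abs_of_nonpos (Real.log_nonpos hzn.le hz1), Real.rpow_def_of_pos hzn]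
        have h5 := Real.add_one_le_exp (-(Real.log ‖z‖ * α))
        rw [Real.exp_neg] at h5
        have h6 := Real.exp_pos (Real.log ‖z‖ * α)
        calc _ ≤ (Real.exp (Real.log ‖z‖ * α))⁻¹ * Real.exp (Real.log ‖z‖ * α) := by
              gcongr
              linarith
          _ = 1 := inv_mul_cancel₀ h6.ne'
      calc _ = α * (α * |Real.log ‖z‖| * ‖z‖ ^ α) + α ^ 2 * B * ‖z‖ ^ α := by ring
        _ ≤ α * 1 + α ^ 2 * B * 1 := by gcongr
        _ ≤ _ := by nlinarith [mul_nonneg hB0 hα.le, sq_nonneg α]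
  calc _ ≤ α ^ (l + 1) * ((|Real.log ‖z‖| + B) ^ l *
        (‖z‖ ^ α * Real.exp (-((2 - β) * Real.pi / 2 * s.im)))) := by
        gcongr
        exact h1.trans (by gcongr)
    _ = α ^ (l + 1) * ((|Real.log ‖z‖| + B) ^ l * ‖z‖ ^ α) *
        Real.exp (-((2 - β) * Real.pi / 2 * s.im)) := by ring
    _ ≤ _ := by gcongr

/-- One factor `z - s_k` cancels, leaving a Lagrange basis function at `z` times `s_k^(α-1)`, a
bounded logarithm and `e^(-π Im s)`. -/
theorem norm_residue_node_le (hβ0 : 0 ≤ β) (hz1 : ‖z‖ ≤ 1)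
    (hne : ∀ k ∈ Finset.Icc 1 ℓ, z ≠ node ℓ k) (hN : NodeBounds q ℓ z) (hq : 1 ≤ q)
    (hα : 0 < α) (hlo : α < ℓ + 1) (hhi : (ℓ : ℝ) < α + 1) (hl : l = 0 ∨ l = 1)
    (hB : |c| + 2 * Real.pi ≤ B) {s : ℂ} (hs : s.re = α) (ha : 0 ≤ s.im) {k : ℕ}
    (hk : k ∈ Finset.Icc 1 ℓ) :
    α ^ (l + 1) * ‖residue c l s ℓ z k‖ ≤
      72 * (1 + B) * (1 + α) ^ 3 * q ^ ℓ * Real.exp (-((2 - β) * Real.pi / 2 * s.im)) := by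
  have hpi := Real.pi_gt_three
  have hB6 : 6 ≤ B := by linarith [abs_nonneg c]
  have hδ := delta_bounds
  set σ := node ℓ k with hσ
  have hσ0 : 0 < σ := node_pos ℓ k
  have hσ1 : delta ≤ σ := delta_le_node ℓ k
  have hσ2 : σ ≤ 1 + delta := node_le ℓ k
  have hpk : polePoint ℓ z k = σ := polePoint_of_mem z hk
  have hσc : (σ : ℂ) ≠ 0 := ofReal_ne_zero.2 hσ0.ne'
  have hnσ : ‖(σ : ℂ)‖ = σ := by rw [norm_real, Real.norm_of_nonneg hσ0.le]
  have hk0 : k ≠ 0 := by have := Finset.mem_Icc.1 hk; omega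
  have herase : (poleIndex ℓ).erase k = insert 0 ((Finset.Icc 1 ℓ).erase k) := by
    rw [poleIndex, Finset.erase_insert_of_ne hk0.symm]
  have hprod : ∏ i ∈ (poleIndex ℓ).erase k, ‖polePoint ℓ z i - σ‖ =
      ‖z - σ‖ * ∏ i ∈ (Finset.Icc 1 ℓ).erase k, |σ - node ℓ i| := by
    rw [herase, Finset.prod_insert (by simp)]
    congr 1
    refine Finset.prod_congr rfl fun i hi => ?_
    rw [polePoint_of_mem z (Finset.mem_of_mem_erase hi), ← ofReal_sub, norm_real,
      Real.norm_eq_abs, abs_sub_comm]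
  have hzs : ‖z - σ‖ ≠ 0 := norm_ne_zero_iff.2 (sub_ne_zero.2 (hne k hk))
  have hres : ‖residue c l s ℓ z k‖ = ‖z‖ *
      (∏ i ∈ (Finset.Icc 1 ℓ).erase k, (‖z - node ℓ i‖ / |σ - node ℓ i|)) *
        (‖numer c l s (pole σ)‖ * σ⁻¹) := by
    rw [residue, hpk, nodeFactor, norm_mul, norm_mul, norm_mul, norm_mul,
      norm_exp_neg_pole hσc, norm_inv, norm_prod, norm_prod, hprod, hnσ,
      ← Finset.mul_prod_erase _ _ hk, Finset.prod_div_distrib, div_eq_mul_inv, mul_inv, ← hσ]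
    field_simp
  have hlog : |Real.log σ| ≤ B := by
    rw [abs_le]
    constructor
    · have := Real.one_sub_inv_le_log_of_pos hσ0
      have h5 : σ⁻¹ ≤ 5 := by
        rw [inv_le_comm₀ hσ0 (by norm_num)]; linarith
      linarith
    · linarith [Real.log_le_sub_one_of_pos hσ0]
  have hBl : (|Real.log ‖(σ : ℂ)‖| + B) ^ l ≤ 2 * (1 + B) := by
    rw [hnσ]
    rcases hl with rfl | rfl
    · simp; linarith
    · rw [pow_one]; linarith
  have hrpow : ‖(σ : ℂ)‖ ^ α ≤ (1 + delta) ^ ℓ * (1 + delta) := by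
    rw [hnσ, ← pow_succ]
    calc σ ^ α ≤ (1 + delta) ^ α := by gcongr
      _ ≤ (1 + delta) ^ ((ℓ + 1 : ℕ) : ℝ) :=
          Real.rpow_le_rpow_of_exponent_le (by linarith) (by push_cast; linarith)
      _ = _ := Real.rpow_natCast _ _
  have hexp : Real.exp (-(s.im * (arg (σ : ℂ) + Real.pi))) ≤
      Real.exp (-((2 - β) * Real.pi / 2 * s.im)) := by
    rw [arg_ofReal_of_nonneg hσ0.le]
    rw [Real.exp_le_exp, neg_le_neg_iff, mul_comm, zero_add]
    exact mul_le_mul_of_nonneg_left (by nlinarith) ha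
  have hinv : σ⁻¹ * (1 + delta) ≤ 6 := by
    rw [inv_mul_le_iff₀ hσ0]; linarith
  have hαl : α ^ (l + 1) ≤ (1 + α) ^ 2 := by
    rcases hl with rfl | rfl
    · simp only [zero_add, pow_one]; nlinarith
    · gcongr; linarith
  have hbasis := hN.basis k hk
  set P := ∏ i ∈ (Finset.Icc 1 ℓ).erase k, (‖z - node ℓ i‖ / |σ - node ℓ i|) with hP
  have hP0 : 0 ≤ P := Finset.prod_nonneg fun i _ => by positivity
  set E := Real.exp (-((2 - β) * Real.pi / 2 * s.im)) with hE
  have hE0 : 0 < E := Real.exp_pos _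
  have hd1 : 0 < 1 + delta := by linarith
  have hB0 : 0 < 1 + B := by linarith
  have hnum : ‖numer c l s (pole σ)‖ ≤ 2 * (1 + B) * ((1 + delta) ^ ℓ * (1 + delta) * E) := by
    refine (norm_numer_pole_le (l := l) hσc hB hs).trans ?_
    refine mul_le_mul hBl ?_ (by positivity) (by positivity)
    exact mul_le_mul hrpow hexp (Real.exp_pos _).le (by positivity)
  rw [hres]
  clear_value P E σ
  have hzP : ‖z‖ * P ≤ P := mul_le_of_le_one_left hP0 hz1
  have h7 : ‖z‖ * P * (‖numer c l s (pole σ)‖ * σ⁻¹) ≤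
      P * (2 * (1 + B) * ((1 + delta) ^ ℓ * (1 + delta) * E) * σ⁻¹) :=
    mul_le_mul hzP (mul_le_mul_of_nonneg_right hnum (by positivity)) (by positivity) hP0
  have h8 : (P * (1 + delta) ^ ℓ) * (σ⁻¹ * (1 + delta)) ≤ (3 * (ℓ + 1) * q ^ ℓ) * 6 :=
    mul_le_mul hbasis hinv (by positivity) (by positivity)
  have h9 : 3 * (ℓ + 1) * q ^ ℓ ≤ 3 * (2 * (1 + α)) * q ^ ℓ := by
    gcongr
    linarith
  calc _ ≤ (1 + α) ^ 2 * (P * (2 * (1 + B) * ((1 + delta) ^ ℓ * (1 + delta) * E) * σ⁻¹)) :=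
        mul_le_mul hαl h7 (by positivity) (by positivity)
    _ = 2 * (1 + B) * (1 + α) ^ 2 * E * ((P * (1 + delta) ^ ℓ) * (σ⁻¹ * (1 + delta))) := by ring
    _ ≤ 2 * (1 + B) * (1 + α) ^ 2 * E * ((3 * (2 * (1 + α)) * q ^ ℓ) * 6) := by
        refine mul_le_mul_of_nonneg_left (h8.trans ?_) (by positivity)
        linarith
    _ = _ := by ring

/-- The bound for one frequency: `s = α + i a` with `a > 0`. -/
theorem norm_integral_kernel_le (hβ0 : 0 ≤ β) (hβ : β < 2) (hz : |arg z| ≤ β * Real.pi / 2)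
    (h0 : z ≠ 0) (hz1 : ‖z‖ ≤ 1) (hne : ∀ k ∈ Finset.Icc 1 ℓ, z ≠ node ℓ k)
    (hN : NodeBounds q ℓ z) (hq : 1 ≤ q) (hα : 0 < α) (hlo : α < ℓ + 1) (hhi : (ℓ : ℝ) < α + 1)
    (hl : l = 0 ∨ l = 1) (hB : |c| + 2 * Real.pi ≤ B) {s : ℂ} (hs : s.re = α) (ha : 0 ≤ s.im) :
    α ^ (l + 1) * ‖∫ x : ℝ, nodeFactor ℓ z * (numer c l s x *
        (∏ j ∈ poleIndex ℓ, (exp x + polePoint ℓ z j))⁻¹)‖ ≤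
      2000 * (1 + B) * (1 + α) ^ 4 * q ^ ℓ * ((1 + kappa α ℓ ^ (l + 1)) / varkappa β) *
        Real.exp (-((2 - β) * Real.pi / 2 * s.im)) := by
  have hpi := Real.pi_gt_three
  have hpi4 := Real.pi_lt_four
  have hslit := mem_slitPlane_of_abs_arg_le hβ h0 hz
  have hps := polePoint_mem_slitPlane (ℓ := ℓ) hslit
  have hvk := varkappa_pos hβ
  have hvk1 := varkappa_le_one β
  obtain ⟨i0, -⟩ := integrable_kernel_and_integral_le (c := c) (B := B) hβ hz h0 hz1 hN hq hα hlo
    hhi hl hs (τ := 0) (by rw [abs_zero]; linarith)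
  -- The height `τ = 2π` is the shifted line, which gains `e^(-2π Im s)`.
  obtain ⟨i1, e1⟩ := integrable_kernel_and_integral_le (c := c) (B := B) hβ hz h0 hz1 hN hq hα hlo
    hhi hl hs (τ := 2 * Real.pi) (by rwa [abs_of_pos (show 0 < 2 * Real.pi by positivity)])
  have hZ := nodeFactor_ne_zero h0 hne
  obtain ⟨tb, tt⟩ := tendsto_numer_mul_inv_prod (S := poleIndex ℓ) (p := polePoint ℓ z) (c := c)
    (l := l) (s := s) (fun j hj => slitPlane_ne_zero (hps j hj)) hl (by rwa [hs])
    (by rw [hs, card_poleIndex]; push_cast; exact hlo)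
  have hci : ∀ f : ℝ → ℂ, Integrable (fun x => nodeFactor ℓ z * f x) → Integrable f := fun f hf => by
    simpa [← mul_assoc, inv_mul_cancel₀ hZ] using hf.const_mul (nodeFactor ℓ z)⁻¹
  have hi0 := hci _ i0
  have hi1 := hci _ i1
  simp only [ofReal_zero, zero_mul, add_zero] at hi0
  push_cast at hi1 e1
  have hshift := integral_sub_integral_shift (S := poleIndex ℓ) (by simp [poleIndex]) hps
    (polePoint_injOn hne) (differentiable_numer c l s) tb tt hi0 hi1
  have hmul := congrArg (fun t => nodeFactor ℓ z * t) hshift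
  simp only [mul_sub] at hmul
  rw [← integral_const_mul, ← integral_const_mul, mul_left_comm, Finset.mul_sum] at hmul
  change _ = 2 * Real.pi * I * ∑ j ∈ poleIndex ℓ, residue c l s ℓ z j at hmul
  rw [sub_eq_iff_eq_add] at hmul
  rw [hmul]
  set E := Real.exp (-((2 - β) * Real.pi / 2 * s.im)) with hE
  have hB0 : 0 ≤ B := by linarith [abs_nonneg c]
  have hkp : 0 ≤ kappa α ℓ ^ (l + 1) := by
    have : 0 ≤ kappa α ℓ := div_nonneg hα.le (by linarith)
    positivity
  have hql : 1 ≤ q ^ ℓ := one_le_pow₀ hq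
  have hEE : Real.exp (-(s.im * (2 * Real.pi))) ≤ E := by
    rw [hE]
    rw [Real.exp_le_exp, neg_le_neg_iff, mul_comm]
    exact mul_le_mul_of_nonneg_left (by nlinarith) ha
  have hsum : α ^ (l + 1) * ∑ j ∈ poleIndex ℓ, ‖residue c l s ℓ z j‖ ≤
      145 * (1 + B) * (1 + α) ^ 4 * q ^ ℓ * E := by
    rw [poleIndex, Finset.sum_insert (by simp), mul_add, Finset.mul_sum]
    have hnodes : ∑ k ∈ Finset.Icc 1 ℓ, α ^ (l + 1) * ‖residue c l s ℓ z k‖ ≤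
        (1 + α) * (72 * (1 + B) * (1 + α) ^ 3 * q ^ ℓ * E) := by
      refine (Finset.sum_le_card_nsmul _ _ _ fun k hk => norm_residue_node_le hβ0 hz1 hne hN hq hα
        hlo hhi hl hB hs ha hk).trans ?_
      rw [nsmul_eq_mul, Nat.card_Icc, Nat.add_sub_cancel]
      gcongr
      linarith
    have hzero := norm_residue_zero_le (ℓ := ℓ) (c := c) hz h0 hz1 hne hα hl hB hs ha
    have : (1 + B) * (1 + α) ^ 2 * E ≤ (1 + B) * (1 + α) ^ 4 * q ^ ℓ * E := by
      refine mul_le_mul_of_nonneg_right ?_ (Real.exp_pos _).le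
      have h24 : (1 + α) ^ 2 ≤ (1 + α) ^ 4 := pow_le_pow_right₀ (by linarith) (by norm_num)
      calc (1 + B) * (1 + α) ^ 2 ≤ (1 + B) * (1 + α) ^ 4 := by gcongr
        _ ≤ (1 + B) * (1 + α) ^ 4 * q ^ ℓ := le_mul_of_one_le_right (by positivity) hql
    have : 0 ≤ (1 + B) * (1 + α) ^ 4 * q ^ ℓ * E := by positivity
    linarith
  have hone : 1 ≤ (1 + kappa α ℓ ^ (l + 1)) / varkappa β := by
    rw [le_div_iff₀ hvk]; linarith
  set W := (1 + kappa α ℓ ^ (l + 1)) / varkappa β with hW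
  set V := (1 + B) * (1 + α) ^ 4 * q ^ ℓ * E with hV
  have hV0 : 0 ≤ V := by positivity
  have hline : q ^ ℓ / varkappa β * Real.exp (-(s.im * (2 * Real.pi))) *
      (4 * (1 + B) * (1 + α) * (1 + kappa α ℓ ^ (l + 1))) ≤ 4 * V * W := by
    calc _ ≤ q ^ ℓ / varkappa β * E *
          (4 * (1 + B) * (1 + α) ^ 4 * (1 + kappa α ℓ ^ (l + 1))) := by
          gcongr
          exact le_self_pow₀ (by linarith) (by norm_num)
      _ = _ := by rw [hV, hW]; ring
  have hres : α ^ (l + 1) * ‖2 * Real.pi * I * ∑ j ∈ poleIndex ℓ, residue c l s ℓ z j‖ ≤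
      8 * (145 * V) := by
    have h2 : ‖2 * (Real.pi : ℂ) * I‖ ≤ 8 := by
      simp [abs_of_pos Real.pi_pos]; linarith
    rw [norm_mul]
    calc _ ≤ α ^ (l + 1) * (8 * ∑ j ∈ poleIndex ℓ, ‖residue c l s ℓ z j‖) := by
          gcongr
          exact norm_sum_le _ _
      _ = 8 * (α ^ (l + 1) * ∑ j ∈ poleIndex ℓ, ‖residue c l s ℓ z j‖) := by ring
      _ ≤ 8 * (145 * V) := by
          refine mul_le_mul_of_nonneg_left (hsum.trans (le_of_eq ?_)) (by norm_num)
          rw [hV]; ring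
  have hVW : V ≤ V * W := le_mul_of_one_le_right hV0 hone
  calc _ ≤ α ^ (l + 1) * (‖2 * Real.pi * I * ∑ j ∈ poleIndex ℓ, residue c l s ℓ z j‖ + _) := by
        gcongr
        exact norm_add_le _ _
    _ ≤ 8 * (145 * V) + 4 * V * W := by
        rw [mul_add]
        exact add_le_add hres (e1.trans hline)
    _ ≤ 2000 * (V * W) := by nlinarith
    _ = _ := by rw [hV]; ring

end Kernel

end Lightning

/-! ### From the kernel to the Fourier transform and its sum over frequencies -/

namespace Lightning

open Complex Filter Topology Set MeasureTheory
open scoped ComplexConjugate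

/-- The integrand in the variable `x = log (C e^{(u - T)/α})`. -/
noncomputable def kernel (c : ℝ) (l : ℕ) (s : ℂ) (ℓ : ℕ) (z : ℂ) (x : ℝ) : ℂ :=
  nodeFactor ℓ z * (numer c l s x * (∏ j ∈ poleIndex ℓ, (exp x + polePoint ℓ z j))⁻¹)

theorem integrand_eq {C α : ℝ} (hC : 0 < C) (hα : 0 < α) (σ : ℝ) (N₁ ℓ l : ℕ) (z : ℂ) (u : ℝ) :
    integrand C α σ N₁ ℓ l z u = (α : ℂ) ^ l *
      kernel (Real.log C) l α ℓ z (α⁻¹ * u + (Real.log C - trunc α σ N₁ / α)) := by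
  set T := trunc α σ N₁
  set x := α⁻¹ * u + (Real.log C - T / α) with hx
  have h1 : C * Real.exp ((u - T) / α) = Real.exp x := by
    rw [hx, show α⁻¹ * u + (Real.log C - T / α) = Real.log C + (u - T) / α by
      field_simp; ring, Real.exp_add, Real.exp_log hC]
  have h2 : u - T = α * (x - Real.log C) := by rw [hx]; field_simp; ring
  have h3 : C ^ α * (u - T) ^ l * Real.exp (u - T) =
      α ^ l * ((x - Real.log C) ^ l * Real.exp (α * x)) := by
    rw [h2, mul_pow, Real.rpow_def_of_pos hC,
      show α * x = Real.log C * α + α * (x - Real.log C) by ring, Real.exp_add]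
    ring
  rw [integrand, h1, h3, kernel, prod_poleIndex ℓ z (fun p => exp x + p), nodeFactor, numer,
    Finset.prod_div_distrib]
  push_cast
  simp only [div_eq_mul_inv, mul_inv]
  ring

theorem integral_comp_affine (g : ℝ → ℂ) {a : ℝ} (ha : 0 < a) (b : ℝ) :
    ∫ u, g (a⁻¹ * u + b) = a * ∫ x, g x := by
  rw [Measure.integral_comp_mul_left (fun y => g (y + b)) a⁻¹, inv_inv, abs_of_pos ha,
    integral_add_right_eq_self g b, real_smul]

/-- The part of the Fourier phase depending on `x` merges into the exponent `s`; the constant part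
has modulus one. The Jacobian adds one power of `α` to the `α^l` already present. -/
theorem norm_fourier_integrand_eq {C α : ℝ} (hC : 0 < C) (hα : 0 < α) (σ : ℝ) (N₁ ℓ l : ℕ) (z : ℂ)
    (ξ : ℝ) : ‖𝓕 (integrand C α σ N₁ ℓ l z) ξ‖ =
      α ^ (l + 1) * ‖∫ x, kernel (Real.log C) l (α - 2 * Real.pi * α * ξ * I) ℓ z x‖ := by
  set T := trunc α σ N₁ with hT
  set c := Real.log C with hc
  set b := c - T / α with hb
  set s : ℂ := α - 2 * Real.pi * α * ξ * I with hs
  have h : ∀ u : ℝ, exp (↑(-2 * Real.pi * u * ξ) * I) • integrand C α σ N₁ ℓ l z u =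
      (exp (↑(-2 * Real.pi * (-(α * b)) * ξ) * I) * (α : ℂ) ^ l) * kernel c l s ℓ z (α⁻¹ * u + b) := by
    intro u
    rw [integrand_eq hC hα, smul_eq_mul, ← hT, ← hc, ← hb]
    set x := α⁻¹ * u + b with hx
    have hu : u = α * x + -(α * b) := by rw [hx]; field_simp; ring
    have hn : numer c l s x = exp (↑(-2 * Real.pi * (α * x) * ξ) * I) * numer c l α x := by
      rw [numer, numer, mul_left_comm, ← exp_add, hs]
      congr 2
      push_cast
      ring
    have he : exp (↑(-2 * Real.pi * u * ξ) * I) = exp (↑(-2 * Real.pi * (-(α * b)) * ξ) * I) *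
        exp (↑(-2 * Real.pi * (α * x) * ξ) * I) := by
      rw [← exp_add, hu]
      congr 1
      push_cast
      ring
    rw [kernel, kernel, hn, he]
    ring
  rw [Real.fourier_real_eq_integral_exp_smul]
  simp_rw [h]
  rw [integral_const_mul, integral_comp_affine _ hα, norm_mul, norm_mul, norm_mul,
    norm_exp_ofReal_mul_I, norm_pow, norm_real, Real.norm_of_nonneg hα.le]
  ring

theorem integrand_conj (C α σ : ℝ) (N₁ ℓ l : ℕ) (z : ℂ) (u : ℝ) :
    integrand C α σ N₁ ℓ l (conj z) u = conj (integrand C α σ N₁ ℓ l z u) := by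
  simp only [integrand, map_mul, map_div₀, map_add, map_prod, map_sub, conj_ofReal]

theorem norm_fourier_conj (C α σ : ℝ) (N₁ ℓ l : ℕ) (z : ℂ) (ξ : ℝ) :
    ‖𝓕 (integrand C α σ N₁ ℓ l z) ξ‖ = ‖𝓕 (integrand C α σ N₁ ℓ l (conj z)) (-ξ)‖ := by
  rw [Real.fourier_real_eq_integral_exp_smul, Real.fourier_real_eq_integral_exp_smul,
    ← norm_conj, ← integral_conj]
  congr 2
  funext u
  rw [integrand_conj, smul_eq_mul, smul_eq_mul, map_mul, ← exp_conj, map_mul, conj_I, conj_ofReal]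
  congr 2
  push_cast
  ring

theorem norm_conj_sub_node (ℓ k : ℕ) (z : ℂ) : ‖conj z - node ℓ k‖ = ‖z - node ℓ k‖ := by
  rw [← norm_conj (z - node ℓ k), map_sub, conj_ofReal]

theorem NodeBounds.conj {q : ℝ} {ℓ : ℕ} {z : ℂ} (h : NodeBounds q ℓ z) :
    NodeBounds q ℓ (conj z) := by
  refine ⟨?_, ?_, ?_⟩ <;> simp only [norm_conj_sub_node]
  exacts [h.small, h.large, h.basis]

theorem abs_arg_conj_eq (z : ℂ) : |arg (conj z)| = |arg z| := by
  rw [arg_conj]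
  split_ifs with h
  · rw [h]
  · rw [abs_neg]

section Frequency

variable {C β q α σ B : ℝ} {N₁ ℓ l : ℕ} {z : ℂ}

theorem norm_fourier_le (hC : 0 < C) (hβ0 : 0 ≤ β) (hβ : β < 2) (hz : |arg z| ≤ β * Real.pi / 2)
    (h0 : z ≠ 0) (hz1 : ‖z‖ ≤ 1) (hne : ∀ k ∈ Finset.Icc 1 ℓ, z ≠ node ℓ k)
    (hN : NodeBounds q ℓ z) (hq : 1 ≤ q) (hα : 0 < α) (hlo : α < ℓ + 1) (hhi : (ℓ : ℝ) < α + 1)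
    (hl : l = 0 ∨ l = 1) (hB : |Real.log C| + 2 * Real.pi ≤ B) (ξ : ℝ) :
    ‖𝓕 (integrand C α σ N₁ ℓ l z) ξ‖ ≤
      2000 * (1 + B) * (1 + α) ^ 4 * q ^ ℓ * ((1 + kappa α ℓ ^ (l + 1)) / varkappa β) *
        Real.exp (-((2 - β) * Real.pi ^ 2 * α * |ξ|)) := by
  -- The nodes are real, so conjugating `z` flips the sign of the frequency; the upward shift needs
  -- `Im s ≥ 0`.
  wlog hξ : ξ ≤ 0 generalizing ξ z
  · rw [norm_fourier_conj, ← abs_neg ξ]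
    refine this (by rwa [abs_arg_conj_eq]) (by simpa using h0) (by simpa using hz1)
      (fun k hk h => hne k hk ?_) hN.conj (-ξ) (by linarith)
    rw [← conj_conj z, h, conj_ofReal]
  rw [norm_fourier_integrand_eq hC hα]
  have hre : ((α : ℂ) - 2 * Real.pi * α * ξ * I).re = α := by simp
  have him : ((α : ℂ) - 2 * Real.pi * α * ξ * I).im = 2 * Real.pi * α * |ξ| := by
    rw [abs_of_nonpos hξ]
    simp
  refine (norm_integral_kernel_le hβ0 hβ hz h0 hz1 hne hN hq hα hlo hhi hl hB hre ?_).trans ?_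
  · rw [him]
    have := Real.pi_pos
    positivity
  · rw [him]
    refine le_of_eq ?_
    congr 3
    ring

theorem integrable_integrand (hC : 0 < C) (hβ : β < 2) (hz : |arg z| ≤ β * Real.pi / 2)
    (h0 : z ≠ 0) (hz1 : ‖z‖ ≤ 1)
    (hN : NodeBounds q ℓ z) (hq : 1 ≤ q) (hα : 0 < α) (hlo : α < ℓ + 1) (hhi : (ℓ : ℝ) < α + 1)
    (hl : l = 0 ∨ l = 1) : Integrable (integrand C α σ N₁ ℓ l z) := by
  obtain ⟨h, -⟩ := integrable_kernel_and_integral_le (c := Real.log C) (s := α) hβ hz h0 hz1 hN hq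
    hα hlo hhi hl (ofReal_re α) (τ := 0) le_rfl
  simp only [ofReal_zero, zero_mul, add_zero] at h
  have h2 := ((h.comp_add_right (Real.log C - trunc α σ N₁ / α)).comp_mul_left'
    (inv_ne_zero hα.ne')).const_mul ((α : ℂ) ^ l)
  exact h2.congr (Eventually.of_forall fun u => (integrand_eq hC hα σ N₁ ℓ l z u).symm)

end Frequency

theorem summable_and_tsum_le_of_le_exp {a : ℤ → ℝ} (ha : ∀ n, 0 ≤ a n) {M X : ℝ} (hX : 0 < X)
    (h : ∀ n : ℤ, a n ≤ M * Real.exp (-(X * |(n : ℝ)|))) :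
    Summable (fun n : {n : ℤ // n ≠ 0} => a n) ∧
      ∑' n : {n : ℤ // n ≠ 0}, a n ≤ 2 * M / (Real.exp X - 1) := by
  set r := Real.exp (-X) with hr
  have hr0 : 0 < r := Real.exp_pos _
  have hr1 : r < 1 := Real.exp_lt_one_iff.2 (by linarith)
  -- The value `0` at `n = 0` lets the sum over nonzero integers be computed over all of `ℤ`, as two
  -- equal geometric series.
  set g : ℤ → ℝ := fun n => if n = 0 then 0 else M * r ^ n.natAbs with hg
  have hgeo : HasSum (fun n : ℕ => M * r ^ (n + 1)) (M / (Real.exp X - 1)) := by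
    have h1 := (hasSum_geometric_of_lt_one hr0.le hr1).mul_left (M * r)
    have hE : Real.exp X = r⁻¹ := by rw [hr, Real.exp_neg, inv_inv]
    have hne : 1 - r ≠ 0 := by linarith
    have h2 : M * r * (1 - r)⁻¹ = M / (Real.exp X - 1) := by
      rw [hE]
      field_simp
    rw [h2] at h1
    convert! h1 using 2 with n
    ring
  have hpos : HasSum (fun n : ℕ => g n) (M / (Real.exp X - 1)) := by
    rw [← hasSum_nat_add_iff' 1]
    simp only [Finset.range_one, Finset.sum_singleton]
    have : g ((0 : ℕ) : ℤ) = 0 := by simp [hg]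
    rw [this, sub_zero]
    have he : (fun n : ℕ => g ((n + 1 : ℕ) : ℤ)) = fun n => M * r ^ (n + 1) := funext fun n => by
      simp only [hg]
      rw [if_neg (by omega), Int.natAbs_natCast]
    rwa [he]
  have hneg : HasSum (fun n : ℕ => g (-(n + 1))) (M / (Real.exp X - 1)) := by
    have he : (fun n : ℕ => g (-(n + 1))) = fun n => M * r ^ (n + 1) := funext fun n => by
      simp only [hg]
      rw [if_neg (by omega)]
      congr 2
    rwa [he]
  have hsum := hpos.of_nat_of_neg_add_one hneg
  rw [← add_div, ← two_mul] at hsum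
  have hsub : HasSum (fun n : {n : ℤ // n ≠ 0} => g n) (2 * M / (Real.exp X - 1)) :=
    (hasSum_subtype_iff_of_support_subset (s := {n : ℤ | n ≠ 0}) (fun n hn h0 => by
      simp [hg, h0] at hn)).2 hsum
  have hle : ∀ n : {n : ℤ // n ≠ 0}, a n ≤ g n := fun n => by
    refine (h n).trans (le_of_eq ?_)
    simp only [hg]
    rw [if_neg n.2, hr, ← Real.exp_nat_mul, Nat.cast_natAbs, Int.cast_abs]
    congr 2
    ring
  have hs := Summable.of_nonneg_of_le (fun n : {n : ℤ // n ≠ 0} => ha n) hle hsub.summable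
  exact ⟨hs, hsub.tsum_eq ▸ hs.tsum_le_tsum hle hsub.summable⟩

/-- With `ε = log(G/q) > 0`, the quartic term of the exponential series bounds `(ε(1+α))^4/24` by
`(G/q)^(1+α)`. -/
theorem exists_pow_mul_rpow_le {q G : ℝ} (hq : 1 ≤ q) (hG : q < G) :
    ∃ K : ℝ, 0 < K ∧ ∀ α : ℝ, 0 < α → (1 + α) ^ 4 * q ^ α ≤ K * G ^ α := by
  have hq0 : 0 < q := by linarith
  have hG0 : 0 < G := by linarith
  set ε := Real.log (G / q) with hε
  have hε0 : 0 < ε := Real.log_pos (by rwa [one_lt_div hq0])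
  refine ⟨24 / ε ^ 4 * (G / q), by positivity, fun α hα => ?_⟩
  have h1 := Real.pow_div_factorial_le_exp (ε * (1 + α)) (by positivity) 4
  have h2 : Real.exp (ε * (1 + α)) = G / q * (G ^ α / q ^ α) := by
    rw [mul_add, mul_one, Real.exp_add, hε, Real.exp_log (by positivity),
      ← Real.rpow_def_of_pos (by positivity), Real.div_rpow hG0.le hq0.le]
  rw [h2, mul_pow, show ((Nat.factorial 4 : ℕ) : ℝ) = 24 by norm_num [Nat.factorial],
    div_le_iff₀ (by norm_num)] at h1
  have hqa : 0 < q ^ α := by positivity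
  calc _ = (ε ^ 4 * (1 + α) ^ 4) * (q ^ α / ε ^ 4) := by field_simp
    _ ≤ (G / q * (G ^ α / q ^ α) * 24) * (q ^ α / ε ^ 4) := by gcongr
    _ = _ := by field_simp

theorem step_pos {α σ : ℝ} (hα : 0 < α) (hσ : 0 < σ) {N₁ : ℕ} (hN : 1 ≤ N₁) : 0 < step α σ N₁ := by
  have : (0 : ℝ) < N₁ := by exact_mod_cast hN
  unfold step
  positivity

theorem exists_fourierSumLE {C : ℝ} (hC : 0 < C) {q G : ℝ} (hq : 1 ≤ q) (hG : q < G) :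
    ∃ K : ℝ, 0 < K ∧ ∀ β : ℝ, 0 ≤ β → β < 2 → ∀ α σ : ℝ, 0 < α → 0 < σ → ∀ N₁ : ℕ, 1 ≤ N₁ →
      ∀ ℓ : ℕ, (ℓ = ⌊α⌋₊ ∨ ℓ = ⌈α⌉₊) → ∀ l : ℕ, (l = 0 ∨ l = 1) →
      ∀ z : ℂ, z ∈ sector β → z ≠ 0 →
      ((∀ k ∈ Finset.Icc 1 ℓ, z ≠ node ℓ k) → NodeBounds q ℓ z) →
      FourierSumLE C α σ N₁ ℓ l z (K * rate G C α σ β N₁ ℓ l) := by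
  obtain ⟨K₀, hK₀, hgrow⟩ := exists_pow_mul_rpow_le hq hG
  set B := |Real.log C| + 2 * Real.pi with hB
  have hB0 : 0 < 1 + B := by have := Real.pi_pos; positivity
  have hq0 : 0 < q := by linarith
  -- `4000` is twice `2000` because both signs of `n` contribute; the extra `q` comes from `q^ℓ ≤ q
  -- · q^α`, as `ℓ < α + 1`.
  refine ⟨4000 * (1 + B) * q * K₀, by positivity, ?_⟩
  intro β hβ0 hβ α σ hα hσ N₁ hN₁ ℓ hℓ l hl z hz h0 hbounds
  have hh := step_pos hα hσ hN₁
  have hvk := varkappa_pos hβ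
  have hlo : α < ℓ + 1 := by
    rcases hℓ with rfl | rfl
    · exact Nat.lt_floor_add_one α
    · linarith [Nat.le_ceil α]
  have hhi : (ℓ : ℝ) < α + 1 := by
    rcases hℓ with rfl | rfl
    · linarith [Nat.floor_le hα.le]
    · exact Nat.ceil_lt_add_one hα.le
  have hkap : 0 ≤ kappa α ℓ ^ (l + 1) := by
    have : 0 ≤ kappa α ℓ := div_nonneg hα.le (by linarith)
    positivity
  set X := (2 - β) * α * Real.pi ^ 2 / step α σ N₁ with hX
  have hX0 : 0 < X := by
    have := Real.pi_pos
    have : 0 < 2 - β := by linarith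
    positivity
  have hE : 0 < Real.exp X - 1 := by linarith [Real.add_one_lt_exp hX0.ne']
  have hG0 : 0 < G := by linarith
  have hrate : 0 ≤ rate G C α σ β N₁ ℓ l := by
    unfold rate
    rw [← hX]
    positivity
  by_cases hne : ∀ k ∈ Finset.Icc 1 ℓ, z ≠ node ℓ k
  · have hN := hbounds hne
    obtain ⟨hz1, harg⟩ := norm_le_and_abs_arg_le_of_mem_sector hβ hz h0
    refine ⟨integrable_integrand hC hβ harg h0 hz1 hN hq hα hlo hhi hl, ?_⟩
    set M := 2000 * (1 + B) * (1 + α) ^ 4 * q ^ ℓ * ((1 + kappa α ℓ ^ (l + 1)) / varkappa β)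
      with hM
    have hterm : ∀ n : ℤ, ‖𝓕 (integrand C α σ N₁ ℓ l z) ((n : ℝ) / step α σ N₁)‖ ≤
        M * Real.exp (-(X * |(n : ℝ)|)) := fun n => by
      refine (norm_fourier_le hC hβ0 hβ harg h0 hz1 hne hN hq hα hlo hhi hl hB.ge _).trans
        (le_of_eq ?_)
      rw [abs_div, abs_of_pos hh, hX]
      congr 3
      ring
    obtain ⟨hs, ht⟩ := summable_and_tsum_le_of_le_exp
      (a := fun n : ℤ => ‖𝓕 (integrand C α σ N₁ ℓ l z) ((n : ℝ) / step α σ N₁)‖)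
      (fun _ => norm_nonneg _) hX0 hterm
    refine ⟨hs, ht.trans ?_⟩
    have hql : q ^ ℓ ≤ q * q ^ α := by
      rw [← Real.rpow_natCast, ← Real.rpow_one_add' hq0.le (by linarith)]
      exact Real.rpow_le_rpow_of_exponent_le hq (by linarith)
    have hg := hgrow α hα
    have hmax : G ^ α ≤ G ^ α * max 1 (C ^ α) :=
      le_mul_of_one_le_right (by positivity) (le_max_left _ _)
    have hpoly : (1 + α) ^ 4 * q ^ ℓ ≤ q * K₀ * (G ^ α * max 1 (C ^ α)) := by
      calc _ ≤ (1 + α) ^ 4 * (q * q ^ α) := by gcongr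
        _ = q * ((1 + α) ^ 4 * q ^ α) := by ring
        _ ≤ q * (K₀ * (G ^ α * max 1 (C ^ α))) := by
          refine mul_le_mul_of_nonneg_left (hg.trans ?_) hq0.le
          exact mul_le_mul_of_nonneg_left hmax hK₀.le
        _ = _ := by ring
    have hw : 0 ≤ (1 + kappa α ℓ ^ (l + 1)) / varkappa β / (Real.exp X - 1) := by positivity
    calc 2 * M / (Real.exp X - 1) = 4000 * (1 + B) * ((1 + α) ^ 4 * q ^ ℓ) *
          ((1 + kappa α ℓ ^ (l + 1)) / varkappa β / (Real.exp X - 1)) := by rw [hM]; ring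
      _ ≤ 4000 * (1 + B) * (q * K₀ * (G ^ α * max 1 (C ^ α))) *
          ((1 + kappa α ℓ ^ (l + 1)) / varkappa β / (Real.exp X - 1)) := by
          refine mul_le_mul_of_nonneg_right ?_ hw
          exact mul_le_mul_of_nonneg_left hpoly (by positivity)
      _ = _ := by
          unfold rate
          rw [← hX, div_div]
          ring
  -- If `z` is a node, a factor of the product is zero and the integrand vanishes identically.
  · push Not at hne
    obtain ⟨k, hk, hzk⟩ := hne
    have hzero : integrand C α σ N₁ ℓ l z = 0 := by
      funext u
      rw [integrand, Finset.prod_eq_zero hk (by rw [hzk, sub_self, zero_div]), mul_zero]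
      rfl
    have hF : ∀ ξ : ℝ, 𝓕 (integrand C α σ N₁ ℓ l z) ξ = 0 := fun ξ => by
      rw [hzero, Real.fourier_real_eq_integral_exp_smul]
      simp
    refine ⟨hzero ▸ integrable_zero _ _ _, ?_⟩
    simp only [hF, norm_zero]
    refine ⟨summable_zero, ?_⟩
    rw [tsum_zero]
    positivity

theorem eq_ofReal_of_mem_sector_zero {z : ℂ} (hz : z ∈ sector 0) (h0 : z ≠ 0) :
    ∃ x : ℝ, 0 < x ∧ x ≤ 1 ∧ z = x := by
  obtain ⟨x, hx, θ, hθ, h⟩ := hz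
  have hθ0 : θ = 0 := le_antisymm hθ.2 hθ.1
  have hzx : z = x := by rcases h with h | h <;> simpa [hθ0] using h
  refine ⟨x, hx.1.lt_of_ne fun h => h0 ?_, hx.2, hzx⟩
  rw [hzx, ← h, ofReal_zero]

end Lightning

theorem theorem5p2 (C : ℝ) (hC : 0 < C) :
    (∃ K : ℝ, 0 < K ∧
      ∀ β : ℝ, 0 ≤ β → β < 2 →
      ∀ α σ : ℝ, 0 < α → 0 < σ →
      ∀ N₁ : ℕ, 1 ≤ N₁ →
      ∀ ℓ : ℕ, (ℓ = ⌊α⌋₊ ∨ ℓ = ⌈α⌉₊) →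
      ∀ l : ℕ, (l = 0 ∨ l = 1) →
      ∀ z : ℂ, z ∈ Lightning.sector β → z ≠ 0 →
        Lightning.FourierSumLE C α σ N₁ ℓ l z
          (K * Lightning.rate ((Real.sqrt 2 + 2) / (Real.sqrt 2 - 1)) C α σ β N₁ ℓ l)) ∧
    (∃ K : ℝ, 0 < K ∧
      ∀ α σ : ℝ, 0 < α → 0 < σ →
      ∀ N₁ : ℕ, 1 ≤ N₁ →
      ∀ ℓ : ℕ, (ℓ = ⌊α⌋₊ ∨ ℓ = ⌈α⌉₊) →
      ∀ l : ℕ, (l = 0 ∨ l = 1) →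
      ∀ z : ℂ, z ∈ Lightning.sector 0 → z ≠ 0 →
        Lightning.FourierSumLE C α σ N₁ ℓ l z
          (K * Lightning.rate (Real.sqrt 2 / (Real.sqrt 2 - 1)) C α σ 0 N₁ ℓ l)) := by
  have hs := Lightning.sqrt_two_bounds
  have hs1 : 0 < Real.sqrt 2 - 1 := by linarith
  constructor
  -- Here `𝒢 ≈ 8.243`, just above `8.1`; for `β = 0` below, `𝒢 ≈ 3.414` exceeds `3.4`.
  · obtain ⟨K, hK, h⟩ := Lightning.exists_fourierSumLE hC (q := 8.1)
      (G := (Real.sqrt 2 + 2) / (Real.sqrt 2 - 1)) (by norm_num)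
      (by rw [lt_div_iff₀ hs1]; linarith)
    refine ⟨K, hK, fun β hβ0 hβ α σ hα hσ N₁ hN₁ ℓ hℓ l hl z hz h0 =>
      h β hβ0 hβ α σ hα hσ N₁ hN₁ ℓ hℓ l hl z hz h0 fun _ => ?_⟩
    exact Lightning.nodeBounds_of_norm_le_one ℓ
      (Lightning.norm_le_and_abs_arg_le_of_mem_sector hβ hz h0).1
  · obtain ⟨K, hK, h⟩ := Lightning.exists_fourierSumLE hC (q := 3.4)
      (G := Real.sqrt 2 / (Real.sqrt 2 - 1)) (by norm_num)
      (by rw [lt_div_iff₀ hs1]; linarith)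
    refine ⟨K, hK, fun α σ hα hσ N₁ hN₁ ℓ hℓ l hl z hz h0 =>
      h 0 le_rfl two_pos α σ hα hσ N₁ hN₁ ℓ hℓ l hl z hz h0 fun hne => ?_⟩
    obtain ⟨x, hx0, hx1, rfl⟩ := Lightning.eq_ofReal_of_mem_sector_zero hz h0
    exact Lightning.nodeBounds_of_mem_Ioc ℓ hx0 hx1 fun k hk hxk => hne k hk (by rw [hxk])
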